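/- Let $\mathcal S$ be the following triangulation, with one vertex, 10 edges and 10 tetrahedra $0,\dots,9$, whose space with the vertex removed is (the interior of) the exterior $B$ of the knot K13n586. Each tetrahedron has vertices $0,1,2,3$, and its face $\mathrm F_f$ is the one opposite to vertex $f$. An entry $T'(p_0p_1p_2p_3)$ in row $T$, column $\mathrm F_f$ of the table says that face $\mathrm F_f$ of tetrahedron $T$ is glued affinely to tetrahedron $T'$, each vertex $i\neq f$ going to vertex $p_i$ of $T'$: $$\begin{array}{c|cccc} & \mathrm F_0 & \mathrm F_1 & \mathrm F_2 & \mathrm F_3\\ \hline 0 & 2(0132) & 1(0132) & 7(0213) & 5(2103) \\ 1 & 4(3012) & 0(0132) & 6(3120) & 3(0132) \\ 2 & 0(0132) & 5(0213) & 3(1302) & 9(3120) \\ 3 & 2(2031) & 9(0132) & 1(0132) & 8(2103) \\ 4 & 7(3120) & 8(0132) & 9(3120) & 1(1230) \\ 5 & 7(0132) & 6(0132) & 2(0213) & 0(2103) \\ 6 & 9(3012) & 5(0132) & 1(3120) & 8(0132) \\ 7 & 5(0132) & 0(0213) & 8(1302) & 4(3120) \\ 8 & 7(2031) & 4(0132)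 & 6(0132) & 3(2103) \\ 9 & 2(3120) & 3(0132) & 4(3120) & 6(1230) \end{array}$$ The space $|\mathcal S|$ is the quotient of the disjoint union of the ten tetrahedra by these gluings. An elementary triangle at vertex $i$ of a tetrahedron is the convex hull of one interior point on each of the three edges at $i$. An elementary quadrilateral (of the only type used here) has as corners interior points of the edges $02,12,13,03$, in this cyclic order, so that it separates edge $01$ from edge $23$; it is the cone from the centroid of its corners over the closed polygon through them (the planar quadrilateral, if the corners are coplanar). A normal surface with normal coordinates $c=(t_0,t_1,t_2,t_3,q)_T$ is a subset of $|\mathcal S|$ that meets each tetrahedron $T$ in a disjoint union of elementary disks, namely exactly $t_i$ triangles at vertex $i$ ($i=0,\dots,3$) and $q$ quadrilaterals. Let $F$ and $G$ be the normal surfaces (both of genus 2) with the normal coordinates $$\begin{array}{c|cc} T & F & G\\ \hline 0 & (2,0,0,0,2) & (2,0,2,0,0) \\ 1 & (3,1,0,0,1) & (1,1,0,2,1) \\ 2 & (1,1,0,0,1) & (2,0,0,2,0) \\ 3 & (3,1,1,1,0) & (1,1,2,0,1) \\ 4 & (2,0,0,2,0) & (2,0,1,1,1) \\ 5 & (2,0,2,0,0)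 & (2,0,0,0,2) \\ 6 & (1,1,0,2,1) & (3,1,0,0,1) \\ 7 & (2,0,0,2,0) & (1,1,0,0,1) \\ 8 & (1,1,2,0,1) & (3,1,1,1,0) \\ 9 & (2,0,1,1,1) & (2,0,0,2,0) \end{array}$$ and for $u,v\in\mathbb N=\{0,1,2,\dots\}$ let the normal sum $uF+vG$ be the normal surface whose normal coordinates are $u$ times those of $F$ plus $v$ times those of $G$. If $\gcd(u,v)=1$, then $uF+vG$ is a connected surface; that is, a normal surface with these normal coordinates exists, and every normal surface with these normal coordinates is connected. -/

import Mathlib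

namespace NormalSurfaces

/-- Face-pairing data for `n` tetrahedra, each with vertices `0, 1, 2, 3`; face `f` is the one
opposite to vertex `f`.  Face `f` of tetrahedron `T` is glued to a face of tetrahedron `tet T f`, and
each vertex `i ≠ f` of that face is glued to vertex `vert T f i`.  The redundant value `vert T f f`
is the index of the face of `tet T f` that is used. -/
structure FaceGluing (n : ℕ) where
  tet : Fin n → Fin 4 → Fin n
  vert : Fin n → Fin 4 → Fin 4 → Fin 4
  tet_tet : ∀ T f, tet (tet T f) (vert T f f) = T
  vert_vert : ∀ T f i, vert (tet T f) (vert T f f) (vert T f i) = i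
  ne_self : ∀ T f, (tet T f, vert T f f) ≠ (T, f)

namespace FaceGluing

variable {n : ℕ}

/-- The identifications of points of the disjoint union of the `n` standard tetrahedra (in
barycentric coordinates) that are made by the affine gluing maps of the faces. -/
def Glued (𝒯 : FaceGluing n) (a b : Fin n × stdSimplex ℝ (Fin 4)) : Prop :=
  ∃ f : Fin 4, a.2 f = 0 ∧ b.1 = 𝒯.tet a.1 f ∧ ∀ i, b.2 (𝒯.vert a.1 f i) = a.2 i

/-- The triangulated space: the disjoint union of the tetrahedra modulo the face gluings, with the
quotient topology. -/
abbrev Space (𝒯 : FaceGluing n) : Type := Quot 𝒯.Glued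

/-- The characteristic map of the tetrahedron `T`. -/
def charMap (𝒯 : FaceGluing n) (T : Fin n) (x : stdSimplex ℝ (Fin 4)) : 𝒯.Space :=
  Quot.mk 𝒯.Glued (T, x)

end FaceGluing

/-- The disk types in a tetrahedron that we use: the triangle cutting off the vertex `i`, and the
quadrilateral separating the edge `01` from the edge `23`. -/
inductive DiskType where
  | tri (i : Fin 4) : DiskType
  | quad : DiskType

/-- The point at parameter `s` on the edge from vertex `i` to vertex `j` of the standard
tetrahedron. -/
noncomputable def edgePoint (i j : Fin 4) (s : ℝ) : Fin 4 → ℝ :=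
  (1 - s) • Pi.single i 1 + s • Pi.single j 1

/-- `D` is an elementary triangle at the vertex `i`: it is spanned by one interior point on each of
the three edges at `i`. -/
def IsElementaryTriangle (i : Fin 4) (D : Set (Fin 4 → ℝ)) : Prop :=
  ∃ s : Fin 4 → ℝ, (∀ j, s j ∈ Set.Ioo (0 : ℝ) 1) ∧
    D = convexHull ℝ {x | ∃ j, j ≠ i ∧ x = edgePoint i j (s j)}

/-- `D` is an elementary quadrilateral separating the edge `01` from the edge `23`.  Its corners, in
cyclic order, are interior points of the edges `02`, `12`, `13`, `03`, and `D` is the cone from the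
centroid of the four corners over the closed polygon through them (if the corners are coplanar, this
cone is the planar quadrilateral). -/
def IsElementaryQuad (D : Set (Fin 4 → ℝ)) : Prop :=
  ∃ (s : Fin 4 → ℝ) (p : Fin 4 → Fin 4 → ℝ) (b : Fin 4 → ℝ),
    (∀ k, s k ∈ Set.Ioo (0 : ℝ) 1) ∧
    p = ![edgePoint 0 2 (s 0), edgePoint 1 2 (s 1), edgePoint 1 3 (s 2), edgePoint 0 3 (s 3)] ∧
    b = (1 / 4 : ℝ) • ∑ k, p k ∧
    D = ⋃ k : Fin 4, convexHull ℝ {b, p k, p (k + 1)}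

/-- `D` is an elementary disk of the given type. -/
def IsElementaryDisk : DiskType → Set (Fin 4 → ℝ) → Prop
  | .tri i, D => IsElementaryTriangle i D
  | .quad, D => IsElementaryQuad D

/-- Normal coordinates: the number of elementary disks of each type in each tetrahedron.  The normal
sum of normal surfaces corresponds to the sum of their normal coordinates. -/
abbrev NormalCoord (n : ℕ) : Type := Fin n → DiskType → ℕ

/-- `S` is a normal surface with normal coordinates `c`: it meets each tetrahedron `T` in a disjoint
union of elementary disks, of which exactly `c T t` have type `t`. -/
def IsNormalSurface {n : ℕ} (𝒯 : FaceGluing n) (c : NormalCoord n) (S : Set 𝒯.Space) : Prop :=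
  ∀ T : Fin n, ∃ D : ((t : DiskType) × Fin (c T t)) → Set (Fin 4 → ℝ),
    (∀ a, IsElementaryDisk a.1 (D a)) ∧
    (∀ a b, a ≠ b → Disjoint (D a) (D b)) ∧
    ∀ x : stdSimplex ℝ (Fin 4), 𝒯.charMap T x ∈ S ↔ ∃ a, (x : Fin 4 → ℝ) ∈ D a

/-- Normal coordinates from a table whose rows are the tetrahedra and whose columns are
tri0, tri1, tri2, tri3, quad. -/
def NormalCoord.ofTable {n : ℕ} (M : Fin n → Fin 5 → ℕ) : NormalCoord n
  | T, .tri i => M T i.castSucc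
  | T, .quad => M T 4

/-- The one-vertex triangulation with 10 tetrahedra of the exterior of the knot K13n586 (an ideal
triangulation: the exterior corresponds to the complement of the vertex). -/
def triangulationB : FaceGluing 10 where
  tet := ![
    ![2, 1, 7, 5],
    ![4, 0, 6, 3],
    ![0, 5, 3, 9],
    ![2, 9, 1, 8],
    ![7, 8, 9, 1],
    ![7, 6, 2, 0],
    ![9, 5, 1, 8],
    ![5, 0, 8, 4],
    ![7, 4, 6, 3],
    ![2, 3, 4, 6]]
  vert := ![
    ![![0, 1, 3, 2], ![0, 1, 3, 2], ![0, 2, 1, 3], ![2, 1, 0, 3]],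
    ![![3, 0, 1, 2], ![0, 1, 3, 2], ![3, 1, 2, 0], ![0, 1, 3, 2]],
    ![![0, 1, 3, 2], ![0, 2, 1, 3], ![1, 3, 0, 2], ![3, 1, 2, 0]],
    ![![2, 0, 3, 1], ![0, 1, 3, 2], ![0, 1, 3, 2], ![2, 1, 0, 3]],
    ![![3, 1, 2, 0], ![0, 1, 3, 2], ![3, 1, 2, 0], ![1, 2, 3, 0]],
    ![![0, 1, 3, 2], ![0, 1, 3, 2], ![0, 2, 1, 3], ![2, 1, 0, 3]],
    ![![3, 0, 1, 2], ![0, 1, 3, 2], ![3, 1, 2, 0], ![0, 1, 3, 2]],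
    ![![0, 1, 3, 2], ![0, 2, 1, 3], ![1, 3, 0, 2], ![3, 1, 2, 0]],
    ![![2, 0, 3, 1], ![0, 1, 3, 2], ![0, 1, 3, 2], ![2, 1, 0, 3]],
    ![![3, 1, 2, 0], ![0, 1, 3, 2], ![3, 1, 2, 0], ![1, 2, 3, 0]]]
  tet_tet := by decide
  vert_vert := by decide
  ne_self := by decide

/-- The normal coordinates of the surface `F`. -/
def coordF : NormalCoord 10 := NormalCoord.ofTable ![
  ![2, 0, 0, 0, 2],
  ![3, 1, 0, 0, 1],
  ![1, 1, 0, 0, 1],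
  ![3, 1, 1, 1, 0],
  ![2, 0, 0, 2, 0],
  ![2, 0, 2, 0, 0],
  ![1, 1, 0, 2, 1],
  ![2, 0, 0, 2, 0],
  ![1, 1, 2, 0, 1],
  ![2, 0, 1, 1, 1]]

/-- The normal coordinates of the surface `G`. -/
def coordG : NormalCoord 10 := NormalCoord.ofTable ![
  ![2, 0, 2, 0, 0],
  ![1, 1, 0, 2, 1],
  ![2, 0, 0, 2, 0],
  ![1, 1, 2, 0, 1],
  ![2, 0, 1, 1, 1],
  ![2, 0, 0, 0, 2],
  ![3, 1, 0, 0, 1],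
  ![1, 1, 0, 0, 1],
  ![3, 1, 1, 1, 0],
  ![2, 0, 0, 2, 0]]

end NormalSurfaces

/-! Existence. The coordinates of `F` and `G` satisfy the matching equations, hence so do those of
uF + vG. Space the corners evenly along every edge of every tetrahedron. The position of a corner
then depends only on its rank on the edge and on the weight of the edge. By the matching equations
the weights agree across a face, and every arc has a partner of equal rank on the other side, so the
disks fit together (`Matching.exists_isNormalSurface`). It remains to see that this stacking makes
the disks of one tetrahedron disjoint (`disjoint_disk_position`).

Connectedness. Every point of a normal surface is joined inside its disk to a corner, so only the
points on the ten edges matter. Disjoint arcs in a face that cut off the same vertex are nested, and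
they lie closer to it than the arcs at the other vertices. So they join the m-th point on one edge,
counted from this vertex, to the m-th point on the other (`IsNormalSurface.joinedIn_edgeNth`). These
connections are dictated by the coordinates, hence are available in every surface with these
coordinates.

Edge 01 of tetrahedron 0 carries N = 2u + 2v points, say 0, ..., N - 1. Chains of arcs
(`rel_of_arcs`) connect them by the reflection of the first 2u points, by the reflection of the last
2v points, and by the shift k ↦ k + 2u mod N for k < u + v. The two reflections together are the
single reflection x ↦ 2u - 1 - x of ℤ/N, and conjugation by it extends the shift to all of ℤ/N.
Since gcd(u, u + v) = 1, shifts by 2u and the period 2(u + v) generate the shift by 2, and the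
reflection changes parity. So these points lie in one component
(`rel_of_reflections_of_translation`), and further arcs reach the points of the other nine edges. -/

namespace NormalSurfaces

/-! ### Elementary disks in terms of positions of their corners -/

open Finset

theorem edgePoint_apply (i j l : Fin 4) (s : ℝ) :
    edgePoint i j s l = (1 - s) * (if l = i then 1 else 0) + s * (if l = j then 1 else 0) := by
  simp [edgePoint, Pi.single_apply]

theorem edgePoint_symm (i j : Fin 4) (s : ℝ) : edgePoint i j s = edgePoint j i (1 - s) := by
  ext l
  simp only [edgePoint_apply]
  ring

theorem edgePoint_mem_stdSimplex (i j : Fin 4) {s : ℝ} (hs : s ∈ Set.Icc (0 : ℝ) 1) :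
    edgePoint i j s ∈ stdSimplex ℝ (Fin 4) :=
  (convex_stdSimplex ℝ (Fin 4)) (single_mem_stdSimplex ℝ i) (single_mem_stdSimplex ℝ j)
    (by linarith [hs.2]) hs.1 (by ring)

/-- Positions `p i j` of points on the oriented edges `ij` of a tetrahedron, measured from `i`. -/
def IsPosition (p : Fin 4 → Fin 4 → ℝ) : Prop :=
  ∀ i j, 0 < p i j ∧ p i j + p j i = 1

theorem IsPosition.pos {p : Fin 4 → Fin 4 → ℝ} (hp : IsPosition p) (i j : Fin 4) : 0 < p i j :=
  (hp i j).1

theorem IsPosition.symm {p : Fin 4 → Fin 4 → ℝ} (hp : IsPosition p) (i j : Fin 4) :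
    p j i = 1 - p i j := by
  linarith [(hp i j).2]

theorem IsPosition.lt_one {p : Fin 4 → Fin 4 → ℝ} (hp : IsPosition p) (i j : Fin 4) :
    p i j < 1 := by
  linarith [(hp i j).2, hp.pos j i]

/-- The corners of the quadrilateral with positions `p`. -/
noncomputable def quadCorner (p : Fin 4 → Fin 4 → ℝ) : Fin 4 → Fin 4 → ℝ :=
  ![edgePoint 0 2 (p 0 2), edgePoint 1 2 (p 1 2), edgePoint 1 3 (p 1 3), edgePoint 0 3 (p 0 3)]

/-- The elementary disk of type `t` with corners at the positions `p`. -/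
noncomputable def disk : DiskType → (Fin 4 → Fin 4 → ℝ) → Set (Fin 4 → ℝ)
  | .tri i, p => convexHull ℝ {x | ∃ j, j ≠ i ∧ x = edgePoint i j (p i j)}
  | .quad, p => ⋃ k : Fin 4, convexHull ℝ
      {(1 / 4 : ℝ) • ∑ l, quadCorner p l, quadCorner p k, quadCorner p (k + 1)}

/-- The disk of type `t` has a normal arc in face `f` that cuts off the vertex `i`. -/
def HasArc : DiskType → Fin 4 → Fin 4 → Prop
  | .tri a, f, i => i = a ∧ i ≠ f
  | .quad, f, i => i = (![1, 0, 3, 2] : Fin 4 → Fin 4) f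

instance (t : DiskType) (f i : Fin 4) : Decidable (HasArc t f i) := by
  cases t <;> unfold HasArc <;> infer_instance

/-- The disk of type `t` has a corner on the edge `ij`. -/
def Crosses : DiskType → Fin 4 → Fin 4 → Prop
  | .tri a, i, j => i ≠ j ∧ (i = a ∨ j = a)
  | .quad, i, j => ¬(i < 2 ↔ j < 2)

instance (t : DiskType) (i j : Fin 4) : Decidable (Crosses t i j) := by
  cases t <;> unfold Crosses <;> infer_instance

instance : DecidableEq DiskType := fun
  | .tri i, .tri j => decidable_of_iff (i = j) (by simp)
  | .tri _, .quad => isFalse (by simp)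
  | .quad, .tri _ => isFalse (by simp)
  | .quad, .quad => isTrue rfl

instance : Fintype DiskType where
  elems := insert .quad (univ.image .tri)
  complete t := by cases t <;> simp

theorem sum_diskType {M : Type*} [AddCommMonoid M] (g : DiskType → M) :
    ∑ t, g t = g .quad + ∑ i, g (.tri i) := by
  have h : (univ : Finset DiskType) = insert .quad (univ.image .tri) := rfl
  rw [h, sum_insert (by simp), sum_image (by intro a _ b _ h; simpa using h)]

theorem crosses_symm {t : DiskType} {i j : Fin 4} : Crosses t i j ↔ Crosses t j i := by
  revert t i j; decide

theorem Crosses.ne {t : DiskType} {i j : Fin 4} : Crosses t i j → i ≠ j := by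
  revert t i j; decide

/-- A corner on an edge of a face is an end of an arc in this face, which cuts off one of the two
ends of the edge. -/
theorem crosses_iff_hasArc {t : DiskType} {f i j : Fin 4} (hij : i ≠ j) (hi : f ≠ i) (hj : f ≠ j) :
    Crosses t i j ↔ HasArc t f i ∨ HasArc t f j := by
  revert t f i j; decide

theorem HasArc.unique {t : DiskType} {f i j : Fin 4} :
    HasArc t f i → HasArc t f j → i = j := by
  revert t f i j; decide

theorem HasArc.ne {t : DiskType} {f i : Fin 4} : HasArc t f i → i ≠ f := by
  revert t f i; decide

theorem HasArc.crosses {t : DiskType} {f i j : Fin 4} :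
    HasArc t f i → j ≠ i → j ≠ f → Crosses t i j := by
  revert t f i j; decide

/-- Every elementary disk is determined by its type and the positions of its corners. -/
theorem IsElementaryDisk.exists_eq_disk {t : DiskType} {D : Set (Fin 4 → ℝ)}
    (h : IsElementaryDisk t D) : ∃ p, IsPosition p ∧ D = disk t p := by
  cases t with
  | tri a =>
    obtain ⟨s, hs, rfl⟩ := h
    -- The value 1/2 is a filler for the edges that the disk does not meet; on the diagonal it is
    -- forced by `IsPosition`.
    refine ⟨fun i j ↦ if i = j then 1 / 2 else if i = a then s j else if j = a then 1 - s i
      else 1 / 2, ?_, ?_⟩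
    · intro i j
      have hi := hs i
      have hj := hs j
      simp only [Set.mem_Ioo] at hi hj
      dsimp only
      by_cases hij : i = j
      · subst hij; norm_num
      have hji : ¬ j = i := fun h ↦ hij h.symm
      simp only [hij, hji, if_false]
      by_cases hia : i = a
      · have hja : ¬ j = a := fun h ↦ hji (h.trans hia.symm)
        simp only [hia, hja, if_true, if_false]
        constructor <;> linarith
      · simp only [hia, if_false]
        split_ifs <;> constructor <;> linarith
    · unfold disk
      congr 1
      ext x
      refine exists_congr fun j ↦ and_congr_right fun hj ↦ ?_
      dsimp only
      rw [if_neg (Ne.symm hj), if_pos rfl]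
  | quad =>
    obtain ⟨s, p, b, hs, rfl, rfl, rfl⟩ := h
    refine ⟨![![1 / 2, 1 / 2, s 0, s 3], ![1 / 2, 1 / 2, s 1, s 2],
      ![1 - s 0, 1 - s 1, 1 / 2, 1 / 2], ![1 - s 3, 1 - s 2, 1 / 2, 1 / 2]], ?_, rfl⟩
    have h0 := hs 0
    have h1 := hs 1
    have h2 := hs 2
    have h3 := hs 3
    simp only [Set.mem_Ioo] at h0 h1 h2 h3
    intro i j
    fin_cases i <;> fin_cases j <;> simp <;> norm_num <;> linarith

theorem isElementaryDisk_disk {p : Fin 4 → Fin 4 → ℝ} (hp : IsPosition p) (t : DiskType) :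
    IsElementaryDisk t (disk t p) := by
  cases t with
  | tri a => exact ⟨p a, fun j ↦ ⟨hp.pos a j, hp.lt_one a j⟩, rfl⟩
  | quad =>
    refine ⟨![p 0 2, p 1 2, p 1 3, p 0 3], _, _, ?_, rfl, rfl, rfl⟩
    intro k
    fin_cases k
    exacts [⟨hp.pos _ _, hp.lt_one _ _⟩, ⟨hp.pos _ _, hp.lt_one _ _⟩,
      ⟨hp.pos _ _, hp.lt_one _ _⟩, ⟨hp.pos _ _, hp.lt_one _ _⟩]

/-- The linear function that is `1` on the plane through the points at positions `p i j` on the edges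
at the vertex `i`, and `0` at this vertex. -/
noncomputable def cut (p : Fin 4 → Fin 4 → ℝ) (i : Fin 4) : (Fin 4 → ℝ) →ₗ[ℝ] ℝ :=
  ∑ l ∈ univ.erase i, (p i l)⁻¹ • LinearMap.proj l

theorem cut_apply (p : Fin 4 → Fin 4 → ℝ) (i : Fin 4) (x : Fin 4 → ℝ) :
    cut p i x = ∑ l ∈ univ.erase i, (p i l)⁻¹ * x l := by
  simp [cut]

theorem cut_edgePoint_left (p : Fin 4 → Fin 4 → ℝ) {i j : Fin 4} (hij : j ≠ i) (s : ℝ) :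
    cut p i (edgePoint i j s) = (p i j)⁻¹ * s := by
  rw [cut_apply, sum_eq_single j]
  · simp [edgePoint_apply, hij]
  · intro b hb hbj
    simp [edgePoint_apply, hbj, ne_of_mem_erase hb]
  · simp [hij]

theorem cut_edgePoint_right (p : Fin 4 → Fin 4 → ℝ) {i j : Fin 4} (hij : j ≠ i) (s : ℝ) :
    cut p i (edgePoint j i s) = (p i j)⁻¹ * (1 - s) := by
  rw [edgePoint_symm, cut_edgePoint_left p hij]

/-- Positions are less than 1, so every coefficient of `cut` exceeds 1, while the coordinates other
than `x i` sum to 1. -/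
theorem one_lt_cut {p : Fin 4 → Fin 4 → ℝ} (hp : IsPosition p) {i : Fin 4} {x : Fin 4 → ℝ}
    (hx : x ∈ stdSimplex ℝ (Fin 4)) (hi : x i = 0) : 1 < cut p i x := by
  have h1 : ∑ l ∈ univ.erase i, x l = 1 := by
    rw [← hx.2, ← add_sum_erase univ x (mem_univ i), hi, zero_add]
  rw [cut_apply, ← h1]
  have hle : ∀ l, x l ≤ (p i l)⁻¹ * x l := fun l ↦
    le_mul_of_one_le_left (hx.1 l) (one_lt_inv₀ (hp.pos i l) |>.2 (hp.lt_one i l)).le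
  apply sum_lt_sum (fun l _ ↦ hle l)
  by_contra! hcon
  have : ∀ l ∈ univ.erase i, x l = 0 := by
    intro l hl
    by_contra hne
    have : 0 < x l := lt_of_le_of_ne (hx.1 l) (Ne.symm hne)
    exact absurd (hcon l hl) (not_le.2
      (lt_mul_of_one_lt_left this (one_lt_inv₀ (hp.pos i l) |>.2 (hp.lt_one i l))))
  rw [sum_eq_zero this] at h1
  exact zero_ne_one h1

/-- On the plane `cut p i x = 1` the numbers `(p i l)⁻¹ * x l` are barycentric coordinates of `x`
with respect to the three corners; they are nonnegative in the tetrahedron. -/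
theorem mem_disk_tri {p : Fin 4 → Fin 4 → ℝ} (hp : IsPosition p) {i : Fin 4} {x : Fin 4 → ℝ} :
    x ∈ disk (.tri i) p ↔ x ∈ stdSimplex ℝ (Fin 4) ∧ cut p i x = 1 := by
  constructor
  · intro hx
    refine (convexHull_min (t := stdSimplex ℝ (Fin 4) ∩ {x | cut p i x = 1}) ?_ ?_ hx)
    · rintro _ ⟨j, hj, rfl⟩
      refine ⟨edgePoint_mem_stdSimplex _ _ ⟨(hp.pos i j).le, (hp.lt_one i j).le⟩, ?_⟩
      change cut p i _ = 1
      rw [cut_edgePoint_left p hj, inv_mul_cancel₀ (hp.pos i j).ne']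
    · exact (convex_stdSimplex ℝ (Fin 4)).inter
        (convex_hyperplane (cut p i).isLinear 1)
  · rintro ⟨hx, hc⟩
    have key : x = ∑ l ∈ univ.erase i, ((p i l)⁻¹ * x l) • edgePoint i l (p i l) := by
      ext k
      rw [Finset.sum_apply]
      simp only [Pi.smul_apply, smul_eq_mul]
      by_cases hk : k = i
      · subst hk
        have h1 : ∑ l ∈ univ.erase k, x l = 1 - x k := by
          rw [← hx.2, ← add_sum_erase univ x (mem_univ k)]; ring
        have : ∀ l ∈ univ.erase k, (p k l)⁻¹ * x l * edgePoint k l (p k l) k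
            = (p k l)⁻¹ * x l - x l := by
          intro l hl
          have := (hp.pos k l).ne'
          rw [edgePoint_apply, if_pos rfl, if_neg (ne_of_mem_erase hl).symm]
          field_simp
          ring
        rw [sum_congr rfl this, sum_sub_distrib, ← cut_apply, hc, h1]
        ring
      · rw [sum_eq_single k]
        · have := (hp.pos i k).ne'
          rw [edgePoint_apply, if_neg hk, if_pos rfl]
          field_simp
          ring
        · intro b _ hb
          rw [edgePoint_apply, if_neg hk, if_neg hb.symm]
          ring
        · simp [hk]
    rw [key]
    refine (convex_convexHull ℝ _).sum_mem
      (fun l _ ↦ mul_nonneg (inv_nonneg.2 (hp.pos i l).le) (hx.1 l)) (by rw [← cut_apply, hc])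
      fun l hl ↦ subset_convexHull ℝ _ ⟨l, ne_of_mem_erase hl, rfl⟩

theorem mem_convexHull_triple {E : Type*} [AddCommGroup E] [Module ℝ E] {a b c x : E} :
    x ∈ convexHull ℝ {a, b, c} ↔
      ∃ α β γ : ℝ, 0 ≤ α ∧ 0 ≤ β ∧ 0 ≤ γ ∧ α + β + γ = 1 ∧ x = α • a + β • b + γ • c := by
  constructor
  · intro hx
    rw [convexHull_insert (by simp), convexHull_pair, mem_convexJoin] at hx
    obtain ⟨a', ha, y, ⟨β, γ, hβ, hγ, h1, rfl⟩, ⟨α, δ, hα, hδ, h2, rfl⟩⟩ := hx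
    rw [Set.mem_singleton_iff] at ha
    subst ha
    refine ⟨α, δ * β, δ * γ, hα, mul_nonneg hδ hβ, mul_nonneg hδ hγ, ?_, ?_⟩
    · rw [add_assoc, ← mul_add, h1, mul_one, h2]
    · module
  · rintro ⟨α, β, γ, hα, hβ, hγ, h, rfl⟩
    have := (convex_convexHull ℝ {a, b, c}).sum_mem (t := univ) (w := ![α, β, γ])
      (z := ![a, b, c]) (by intro i _; fin_cases i <;> simpa) (by simpa [Fin.sum_univ_three] using h)
      (by intro i _; apply subset_convexHull; fin_cases i <;> simp)
    simpa [Fin.sum_univ_three] using this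

/-- The point with weights `w` at the corners of a quadrilateral. -/
noncomputable def quadPoint (p : Fin 4 → Fin 4 → ℝ) (w : Fin 4 → ℝ) : Fin 4 → ℝ :=
  ![w 0 * (1 - p 0 2) + w 3 * (1 - p 0 3), w 1 * (1 - p 1 2) + w 2 * (1 - p 1 3),
    w 0 * p 0 2 + w 1 * p 1 2, w 2 * p 1 3 + w 3 * p 0 3]

theorem sum_smul_quadCorner (p : Fin 4 → Fin 4 → ℝ) (w : Fin 4 → ℝ) :
    ∑ k, w k • quadCorner p k = quadPoint p w := by
  ext l
  rw [Finset.sum_apply]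
  fin_cases l <;> simp [Fin.sum_univ_four, quadCorner, quadPoint, edgePoint_apply]

/-- The points of a quadrilateral are the convex combinations of its corners whose weights satisfy a
tropical equation. -/
theorem mem_disk_quad {p : Fin 4 → Fin 4 → ℝ} {x : Fin 4 → ℝ} :
    x ∈ disk .quad p ↔ ∃ w : Fin 4 → ℝ, (∀ k, 0 ≤ w k) ∧ w 0 + w 1 + w 2 + w 3 = 1 ∧
      min (w 0) (w 2) = min (w 1) (w 3) ∧ x = quadPoint p w := by
  simp only [disk, Set.mem_iUnion, mem_convexHull_triple]
  have hsum (α β γ : ℝ) (k : Fin 4) :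
      α • ((1 / 4 : ℝ) • ∑ l, quadCorner p l) + β • quadCorner p k + γ • quadCorner p (k + 1) =
        quadPoint p (fun l ↦ α / 4 + (if l = k then β else 0) + (if l = k + 1 then γ else 0)) := by
    rw [← sum_smul_quadCorner]
    simp only [add_smul, sum_add_distrib, ite_smul, zero_smul, sum_ite_eq', mem_univ, if_true]
    rw [← smul_sum, smul_smul]
    congr 3
    ring
  constructor
  · rintro ⟨k, α, β, γ, hα, hβ, hγ, h, rfl⟩
    refine ⟨_, ?_, ?_, ?_, hsum α β γ k⟩
    · intro l
      split_ifs <;> linarith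
    · fin_cases k <;> simp <;> linarith
    · fin_cases k <;> simp [hβ, hγ]
  · rintro ⟨w, hw, h1, hmin, rfl⟩
    -- In the triangle over the side from `k` to `k + 1` the two opposite weights are equal and
    -- minimal. Taking this minimum off all four corners moves four times its value to the centroid.
    have main (k : Fin 4) (h2 : w (k + 2) ≤ w k) (h3 : w (k + 3) ≤ w (k + 1))
        (h4 : w (k + 2) = w (k + 3)) : ∃ (k : Fin 4) (α β γ : ℝ), 0 ≤ α ∧ 0 ≤ β ∧ 0 ≤ γ ∧
          α + β + γ = 1 ∧ quadPoint p w = α • ((1 / 4 : ℝ) • ∑ l, quadCorner p l) +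
            β • quadCorner p k + γ • quadCorner p (k + 1) := by
      refine ⟨k, 4 * w (k + 2), w k - w (k + 2), w (k + 1) - w (k + 2), by linarith [hw (k + 2)],
        by linarith, by linarith, ?_, ?_⟩
      · fin_cases k <;> simp at h4 ⊢ <;> linarith
      · rw [hsum]
        congr 1
        ext l
        fin_cases k <;> fin_cases l <;> simp at h4 ⊢ <;> linarith
    rcases le_total (w 0) (w 2) with h02 | h02 <;> rcases le_total (w 1) (w 3) with h13 | h13
    · rw [min_eq_left h02, min_eq_left h13] at hmin
      exact main 2 h02 h13 hmin
    · rw [min_eq_left h02, min_eq_right h13] at hmin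
      exact main 1 h13 h02 hmin.symm
    · rw [min_eq_right h02, min_eq_left h13] at hmin
      exact main 3 h13 h02 hmin.symm
    · rw [min_eq_right h02, min_eq_right h13] at hmin
      exact main 0 h02 h13 hmin

end NormalSurfaces

/-! ### Traces of disks in faces, and criteria for disjointness -/

namespace NormalSurfaces

open Finset

theorem add_eq_zero_of_pos_mul {a b r s : ℝ} (ha : 0 ≤ a) (hb : 0 ≤ b) (hr : 0 < r) (hs : 0 < s)
    (h : a * r + b * s = 0) : a = 0 ∧ b = 0 := by
  have h1 := mul_nonneg ha hr.le
  have h2 := mul_nonneg hb hs.le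
  constructor
  · exact (mul_eq_zero.1 (by linarith : a * r = 0)).resolve_right hr.ne'
  · exact (mul_eq_zero.1 (by linarith : b * s = 0)).resolve_right hs.ne'

theorem cut_apply_ite (p : Fin 4 → Fin 4 → ℝ) (i : Fin 4) (x : Fin 4 → ℝ) :
    cut p i x = ∑ l, if l = i then 0 else (p i l)⁻¹ * x l := by
  rw [cut_apply, ← sum_subset (erase_subset i univ)]
  · exact sum_congr rfl fun l hl ↦ (if_neg (ne_of_mem_erase hl)).symm
  · intro l _ hl
    simp at hl
    simp [hl]

/-- The trace of an elementary disk in a face. -/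
theorem mem_disk_face_iff {p : Fin 4 → Fin 4 → ℝ} (hp : IsPosition p) (t : DiskType) {f : Fin 4}
    {x : Fin 4 → ℝ} (hx : x ∈ stdSimplex ℝ (Fin 4)) (hf : x f = 0) :
    x ∈ disk t p ↔ ∃ i, HasArc t f i ∧ cut p i x = 1 := by
  cases t with
  | tri a =>
    rw [mem_disk_tri hp]
    simp only [hx, true_and, HasArc]
    constructor
    · intro h
      refine ⟨a, ⟨rfl, ?_⟩, h⟩
      rintro rfl
      exact (one_lt_cut hp hx hf).ne' h
    · rintro ⟨i, ⟨rfl, _⟩, h⟩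
      exact h
  | quad =>
    simp only [HasArc, exists_eq_left, mem_disk_quad]
    have hsum := hx.2
    have hx0 := hx.1
    rw [Fin.sum_univ_four] at hsum
    have hmin (a b : ℝ) (ha : 0 ≤ a) (hb : 0 ≤ b) : min 0 a = min b 0 := by
      rw [min_eq_left ha, min_eq_right hb]
    have hmin' (a b : ℝ) (ha : 0 ≤ a) (hb : 0 ≤ b) : min 0 a = min 0 b := by
      rw [min_eq_left ha, min_eq_left hb]
    have p02 := hp.pos 0 2
    have p03 := hp.pos 0 3
    have p12 := hp.pos 1 2
    have p13 := hp.pos 1 3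
    have q02 := sub_pos.2 (hp.lt_one 0 2)
    have q03 := sub_pos.2 (hp.lt_one 0 3)
    have q12 := sub_pos.2 (hp.lt_one 1 2)
    have q13 := sub_pos.2 (hp.lt_one 1 3)
    have hcancel (r a : ℝ) (hr : 0 < r) : r⁻¹ * (a * r) = a := by
      field_simp
    have hex (r : ℝ) (hr : 0 < r) (l : Fin 4) : ∃ a, 0 ≤ a ∧ a * r = x l :=
      ⟨x l / r, div_nonneg (hx0 l) hr.le, div_mul_cancel₀ _ hr.ne'⟩
    -- In a face one coordinate vanishes, which kills the two weights with positive coefficients in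
    -- it. Both minima in the tropical equation are then 0, so the trace is the whole segment
    -- between the other two corners.
    fin_cases f <;>
      simp only [cut_apply_ite, Fin.sum_univ_four, Fin.isValue, Matrix.cons_val_zero,
        Matrix.cons_val_one, Matrix.cons_val, Fin.reduceEq, if_true, if_false, Fin.zero_eta,
        Fin.mk_one, Fin.reduceFinMk, hp.symm 0 2, hp.symm 0 3, hp.symm 1 2, hp.symm 1 3]
        at hf ⊢ <;> rw [hf] at hsum <;> rw [hf] <;> constructor
    · rintro ⟨w, hw, h1, -, rfl⟩
      obtain ⟨h0, h3⟩ := add_eq_zero_of_pos_mul (hw 0) (hw 3) q02 q03 (by simpa [quadPoint] using hf)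
      simp only [quadPoint, Matrix.cons_val, h0, h3, zero_mul, mul_zero, zero_add, add_zero]
      rw [hcancel _ _ p12, hcancel _ _ p13]
      linarith
    · intro h
      obtain ⟨a, ha, hax⟩ := hex _ p12 2
      obtain ⟨b, hb, hbx⟩ := hex _ p13 3
      rw [← hax, ← hbx, hcancel _ _ p12, hcancel _ _ p13] at h
      refine ⟨![0, a, b, 0], ?_, ?_, ?_, ?_⟩
      · intro k
        fin_cases k
        exacts [le_rfl, ha, hb, le_rfl]
      · simp; linarith
      · exact (hmin b a hb ha)
      · ext l
        fin_cases l <;> simp [quadPoint, hf] <;> linarith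
    · rintro ⟨w, hw, h1, -, rfl⟩
      obtain ⟨h0, h3⟩ := add_eq_zero_of_pos_mul (hw 1) (hw 2) q12 q13 (by simpa [quadPoint] using hf)
      simp only [quadPoint, Matrix.cons_val, h0, h3, zero_mul, mul_zero, zero_add, add_zero]
      rw [hcancel _ _ p02, hcancel _ _ p03]
      linarith
    · intro h
      obtain ⟨a, ha, hax⟩ := hex _ p02 2
      obtain ⟨b, hb, hbx⟩ := hex _ p03 3
      rw [← hax, ← hbx, hcancel _ _ p02, hcancel _ _ p03] at h
      refine ⟨![a, 0, 0, b], ?_, ?_, ?_, ?_⟩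
      · intro k
        fin_cases k
        exacts [ha, le_rfl, le_rfl, hb]
      · simp; linarith
      · exact (hmin b a hb ha).symm
      · ext l
        fin_cases l <;> simp [quadPoint, hf] <;> linarith
    · rintro ⟨w, hw, h1, -, rfl⟩
      obtain ⟨h0, h3⟩ := add_eq_zero_of_pos_mul (hw 0) (hw 1) p02 p12 (by simpa [quadPoint] using hf)
      simp only [quadPoint, Matrix.cons_val, h0, h3, zero_mul, mul_zero, zero_add, add_zero]
      rw [hcancel _ _ q13, hcancel _ _ q03]
      linarith
    · intro h
      obtain ⟨a, ha, hax⟩ := hex _ q13 1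
      obtain ⟨b, hb, hbx⟩ := hex _ q03 0
      rw [← hax, ← hbx, hcancel _ _ q13, hcancel _ _ q03] at h
      refine ⟨![0, 0, a, b], ?_, ?_, ?_, ?_⟩
      · intro k
        fin_cases k
        exacts [le_rfl, le_rfl, ha, hb]
      · simp; linarith
      · exact (hmin' a b ha hb)
      · ext l
        fin_cases l <;> simp [quadPoint, hf] <;> linarith
    · rintro ⟨w, hw, h1, -, rfl⟩
      obtain ⟨h0, h3⟩ := add_eq_zero_of_pos_mul (hw 2) (hw 3) p13 p03 (by simpa [quadPoint] using hf)
      simp only [quadPoint, Matrix.cons_val, h0, h3, zero_mul, mul_zero, add_zero]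
      rw [hcancel _ _ q02, hcancel _ _ q12]
      linarith
    · intro h
      obtain ⟨a, ha, hax⟩ := hex _ q02 0
      obtain ⟨b, hb, hbx⟩ := hex _ q12 1
      rw [← hax, ← hbx, hcancel _ _ q02, hcancel _ _ q12] at h
      refine ⟨![a, b, 0, 0], ?_, ?_, ?_, ?_⟩
      · intro k
        fin_cases k
        exacts [ha, hb, le_rfl, le_rfl]
      · simp; linarith
      · exact (min_eq_right ha).trans (min_eq_right hb).symm
      · ext l
        fin_cases l <;> simp [quadPoint, hf] <;> linarith

/-- The corners of the disk of type `t` with positions `p`. -/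
def corners (t : DiskType) (p : Fin 4 → Fin 4 → ℝ) : Set (Fin 4 → ℝ) :=
  {x | ∃ k l, Crosses t k l ∧ x = edgePoint k l (p k l)}

theorem quadCorner_mem_corners (p : Fin 4 → Fin 4 → ℝ) (k : Fin 4) :
    quadCorner p k ∈ corners .quad p := by
  fin_cases k
  exacts [⟨0, 2, by decide, rfl⟩, ⟨1, 2, by decide, rfl⟩, ⟨1, 3, by decide, rfl⟩,
    ⟨0, 3, by decide, rfl⟩]

theorem disk_subset_convexHull_corners (t : DiskType) (p : Fin 4 → Fin 4 → ℝ) :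
    disk t p ⊆ convexHull ℝ (corners t p) := by
  cases t with
  | tri a =>
    apply convexHull_mono
    rintro x ⟨j, hj, rfl⟩
    exact ⟨a, j, ⟨hj.symm, Or.inl rfl⟩, rfl⟩
  | quad =>
    intro x hx
    obtain ⟨w, hw, h1, -, rfl⟩ := mem_disk_quad.1 hx
    rw [← sum_smul_quadCorner]
    exact (convex_convexHull ℝ _).sum_mem (fun k _ ↦ hw k) (by rw [Fin.sum_univ_four, h1])
      fun k _ ↦ subset_convexHull ℝ _ (quadCorner_mem_corners p k)

theorem disk_subset_stdSimplex {p : Fin 4 → Fin 4 → ℝ} (hp : IsPosition p) (t : DiskType) :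
    disk t p ⊆ stdSimplex ℝ (Fin 4) := by
  refine (disk_subset_convexHull_corners t p).trans (convexHull_min ?_ (convex_stdSimplex ℝ _))
  rintro x ⟨k, l, -, rfl⟩
  exact edgePoint_mem_stdSimplex k l ⟨(hp.pos k l).le, (hp.lt_one k l).le⟩

/-- A triangle at `i` is disjoint from a disk whose corners on the edges at `i` are all farther from
`i` than those of the triangle. -/
theorem disjoint_disk_tri {p q : Fin 4 → Fin 4 → ℝ} (hp : IsPosition p) (hq : IsPosition q)
    (i : Fin 4) (t : DiskType) (h : ∀ j, Crosses t i j → p i j < q i j) :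
    Disjoint (disk (.tri i) p) (disk t q) := by
  -- By convexity it is enough to look at the corners: those on edges at `i` lie beyond the triangle
  -- by hypothesis, and those on the opposite face by `one_lt_cut`.
  have hsub : disk t q ⊆ {x | 1 < cut p i x} := by
    refine (disk_subset_convexHull_corners t q).trans (convexHull_min ?_
      (convex_halfSpace_gt (cut p i).isLinear 1))
    rintro x ⟨k, l, hkl, rfl⟩
    change 1 < cut p i _
    have hlt (j : Fin 4) (hj : Crosses t i j) : 1 < (p i j)⁻¹ * q i j := by
      rw [← inv_mul_cancel₀ (hp.pos i j).ne']
      exact mul_lt_mul_of_pos_left (h j hj) (inv_pos.2 (hp.pos i j))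
    by_cases hk : k = i
    · subst hk
      rw [cut_edgePoint_left p hkl.ne.symm]
      exact hlt l hkl
    by_cases hl : l = i
    · subst hl
      rw [cut_edgePoint_right p hk, ← hq.symm]
      exact hlt k (crosses_symm.1 hkl)
    · refine one_lt_cut hp (edgePoint_mem_stdSimplex k l ⟨(hq.pos k l).le, (hq.lt_one k l).le⟩) ?_
      rw [edgePoint_apply, if_neg (Ne.symm hk), if_neg (Ne.symm hl)]
      ring
  rw [Set.disjoint_left]
  intro x hx hx'
  exact (hsub hx').ne' ((mem_disk_tri hp).1 hx).2

/-- If convex combinations with nonnegative weights agree although all coefficients of the second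
one are smaller, then some weight increases, or all weights vanish. -/
theorem lt_or_lt_or_eq_zero {a b a' b' r s r' s' : ℝ} (ha : 0 ≤ a) (hb : 0 ≤ b) (ha' : 0 ≤ a')
    (hb' : 0 ≤ b') (hr : 0 < r') (hs : 0 < s') (hrr : r' < r) (hss : s' < s)
    (h : a * r + b * s = a' * r' + b' * s') :
    (a < a' ∨ b < b') ∨ (a = 0 ∧ b = 0 ∧ a' = 0 ∧ b' = 0) := by
  by_contra! hcon
  obtain ⟨⟨h1, h2⟩, h3⟩ := hcon
  have e1 : a' * r' ≤ a * r' := mul_le_mul_of_nonneg_right h1 hr.le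
  have e2 : b' * s' ≤ b * s' := mul_le_mul_of_nonneg_right h2 hs.le
  have e3 : a * r' ≤ a * r := mul_le_mul_of_nonneg_left hrr.le ha
  have e4 : b * s' ≤ b * s := mul_le_mul_of_nonneg_left hss.le hb
  have a0 : a = 0 := by
    have : a * (r - r') = 0 := by linarith
    exact (mul_eq_zero.1 this).resolve_right (by linarith)
  have b0 : b = 0 := by
    have : b * (s - s') = 0 := by linarith
    exact (mul_eq_zero.1 this).resolve_right (by linarith)
  have b1 : b' = 0 := le_antisymm (b0 ▸ h2) hb'
  exact h3 a0 b0 (le_antisymm (a0 ▸ h1) ha') b1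

/-- Quadrilaterals whose corners are in the same order on all four edges are disjoint. -/
theorem disjoint_disk_quad {p q : Fin 4 → Fin 4 → ℝ} (hp : IsPosition p) (hq : IsPosition q)
    (h : ∀ i j, i < 2 → 2 ≤ j → p i j < q i j) : Disjoint (disk .quad p) (disk .quad q) := by
  rw [Set.disjoint_left]
  intro x hx hx'
  obtain ⟨w, hw, h1, hmin, rfl⟩ := mem_disk_quad.1 hx
  obtain ⟨w', hw', h1', hmin', heq⟩ := mem_disk_quad.1 hx'
  have l02 := h 0 2 (by decide) (by decide)
  have l03 := h 0 3 (by decide) (by decide)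
  have l12 := h 1 2 (by decide) (by decide)
  have l13 := h 1 3 (by decide) (by decide)
  have e0 := congrFun heq 0
  have e1 := congrFun heq 1
  have e2 := congrFun heq 2
  have e3 := congrFun heq 3
  simp only [quadPoint, Matrix.cons_val] at e0 e1 e2 e3
  have c0 := lt_or_lt_or_eq_zero (hw 0) (hw 3) (hw' 0) (hw' 3) (sub_pos.2 (hq.lt_one 0 2))
    (sub_pos.2 (hq.lt_one 0 3)) (by linarith) (by linarith) e0
  have c1 := lt_or_lt_or_eq_zero (hw 1) (hw 2) (hw' 1) (hw' 2) (sub_pos.2 (hq.lt_one 1 2))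
    (sub_pos.2 (hq.lt_one 1 3)) (by linarith) (by linarith) e1
  have c2 := lt_or_lt_or_eq_zero (hw' 0) (hw' 1) (hw 0) (hw 1) (hp.pos 0 2)
    (hp.pos 1 2) l02 l12 e2.symm
  have c3 := lt_or_lt_or_eq_zero (hw' 2) (hw' 3) (hw 2) (hw 3) (hp.pos 1 3)
    (hp.pos 0 3) l13 l03 e3.symm
  -- Each coordinate forces one of two neighbouring weights to change in a given direction. Going
  -- around the quadrilateral, opposite weights change alike and adjacent ones oppositely, which
  -- contradicts the equality of the two minima.
  have hup : (w 0 < w' 0 ∧ w 2 < w' 2 ∧ w' 1 < w 1 ∧ w' 3 < w 3) ∨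
      (w' 0 < w 0 ∧ w' 2 < w 2 ∧ w 1 < w' 1 ∧ w 3 < w' 3) := by
    grind
  rcases hup with ⟨u0, u2, u1, u3⟩ | ⟨u0, u2, u1, u3⟩
  · have := min_lt_min u0 u2
    have := min_lt_min u1 u3
    linarith
  · have := min_lt_min u0 u2
    have := min_lt_min u1 u3
    linarith

end NormalSurfaces

/-! ### Existence: evenly spaced corners and the matching equations -/

namespace NormalSurfaces

open Finset

/-- The number of normal arcs in face `f` that cut off the vertex `i`. -/
def numArcs (c : DiskType → ℕ) (f i : Fin 4) : ℕ := ∑ t with HasArc t f i, c t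

/-- The number of corners on the edge `ij`. -/
def weight (c : DiskType → ℕ) (i j : Fin 4) : ℕ := ∑ t with Crosses t i j, c t

theorem weight_comm (c : DiskType → ℕ) (i j : Fin 4) : weight c i j = weight c j i := by
  unfold weight
  congr 1
  ext t
  simp [crosses_symm (i := i)]

theorem weight_eq_add (c : DiskType → ℕ) {f i j : Fin 4} (hij : i ≠ j) (hi : f ≠ i) (hj : f ≠ j) :
    weight c i j = numArcs c f i + numArcs c f j := by
  unfold weight numArcs
  simp only [sum_filter, ← sum_add_distrib]
  refine sum_congr rfl fun t _ ↦ ?_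
  simp only [crosses_iff_hasArc hij hi hj]
  by_cases h1 : HasArc t f i <;> by_cases h2 : HasArc t f j <;> simp [h1, h2]
  exact absurd (h1.unique h2) hij

theorem weight_eq (c : DiskType → ℕ) {i j : Fin 4} (hij : i ≠ j) :
    weight c i j = c (.tri i) + c (.tri j) + if Crosses .quad i j then c .quad else 0 := by
  unfold weight
  rw [sum_filter, sum_diskType, Fin.sum_univ_four]
  fin_cases i <;> fin_cases j <;> simp [Crosses] at hij ⊢ <;> ring

theorem numArcs_eq (c : DiskType → ℕ) {f i : Fin 4} (hi : i ≠ f) :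
    numArcs c f i = c (.tri i) + if HasArc .quad f i then c .quad else 0 := by
  unfold numArcs
  rw [sum_filter, sum_diskType, Fin.sum_univ_four]
  fin_cases i <;> fin_cases f <;> simp [HasArc] at hi ⊢ <;> ring

variable {n : ℕ}

/-- The matching equations: both sides of every face have the same numbers of normal arcs. -/
def FaceGluing.Matching (𝒯 : FaceGluing n) (c : NormalCoord n) : Prop :=
  ∀ T f i, i ≠ f →
    numArcs (c T) f i = numArcs (c (𝒯.tet T f)) (𝒯.vert T f f) (𝒯.vert T f i)

/-- The number of corners on the edge `ij` between the vertex `i` and the disk `d`, if the triangles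
and quadrilaterals are stacked in their order. -/
def rank (c : DiskType → ℕ) : ((t : DiskType) × Fin (c t)) → Fin 4 → Fin 4 → ℕ
  | ⟨.tri a, m⟩, i, j => if i = a then m else weight c i j - 1 - m
  | ⟨.quad, m⟩, i, _ => c (.tri i) + if i < 2 then (m : ℕ) else c .quad - 1 - m

/-- Ranks counted from the two ends are complementary, which makes (rank + 1) / (weight + 1) add up
to 1 over the two orientations. -/
theorem rank_add_rank (c : DiskType → ℕ) (d : (t : DiskType) × Fin (c t)) {i j : Fin 4}
    (h : Crosses d.1 i j) : rank c d i j + rank c d j i + 1 = weight c i j := by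
  have hij := h.ne
  obtain ⟨t | _, m⟩ := d
  · have hm := m.2
    have hw := weight_eq c hij
    have hc := weight_comm c i j
    obtain ⟨-, h | h⟩ := h
    · simp only [rank, h, if_true]
      subst h
      rw [if_neg hij.symm]
      omega
    · simp only [rank, h, if_true]
      subst h
      rw [if_neg hij]
      omega
  · have hm := m.2
    have hw := weight_eq c hij
    have h' : Crosses .quad i j := h
    rw [if_pos h'] at hw
    simp only [rank, hw]
    simp only [Crosses] at h'
    by_cases hi : i < 2 <;> by_cases hj : j < 2 <;> simp [hi, hj] at h' ⊢ <;> omega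

/-- Evenly spaced positions of the corners of the disk `d`. -/
noncomputable def position (c : DiskType → ℕ) (d : (t : DiskType) × Fin (c t)) (i j : Fin 4) : ℝ :=
  if Crosses d.1 i j then (rank c d i j + 1) / (weight c i j + 1) else 1 / 2

theorem isPosition_position (c : DiskType → ℕ) (d : (t : DiskType) × Fin (c t)) :
    IsPosition (position c d) := by
  intro i j
  by_cases h : Crosses d.1 i j
  · have h' := crosses_symm.1 h
    rw [position, position, if_pos h, if_pos h', weight_comm c j i]
    refine ⟨by positivity, ?_⟩
    have := rank_add_rank c d h
    rw [← add_div, div_eq_one_iff_eq (by positivity), ← this]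
    push_cast
    ring
  · have h' := mt crosses_symm.1 h
    rw [position, position, if_neg h, if_neg h']
    norm_num

theorem position_lt (c : DiskType → ℕ) {d e : (t : DiskType) × Fin (c t)} {i j : Fin 4}
    (hd : Crosses d.1 i j) (he : Crosses e.1 i j) (h : rank c d i j < rank c e i j) :
    position c d i j < position c e i j := by
  rw [position, position, if_pos hd, if_pos he]
  have : (rank c d i j : ℝ) < rank c e i j := by exact_mod_cast h
  gcongr

theorem disjoint_disk_tri_of_rank (c : DiskType → ℕ) {a : Fin 4} (m : Fin (c (.tri a)))
    (e : (t : DiskType) × Fin (c t)) (h : ∀ j, Crosses e.1 a j → m < rank c e a j) :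
    Disjoint (disk (.tri a) (position c ⟨.tri a, m⟩)) (disk e.1 (position c e)) := by
  refine disjoint_disk_tri (isPosition_position _ _) (isPosition_position _ _) a e.1 fun j hj ↦ ?_
  refine position_lt c (show Crosses (.tri a) a j from ⟨hj.ne, Or.inl rfl⟩) hj ?_
  simpa [rank] using h j hj

/-- Triangles are separated from other disks by their planes, as soon as the ranks are in the right
order at their vertex. Only pairs of quadrilaterals, which need not be planar, require
`disjoint_disk_quad`. -/
theorem disjoint_disk_position (c : DiskType → ℕ) {d e : (t : DiskType) × Fin (c t)} (hde : d ≠ e) :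
    Disjoint (disk d.1 (position c d)) (disk e.1 (position c e)) := by
  have tri_quad (a : Fin 4) (m : Fin (c (.tri a))) (k : Fin (c .quad)) :
      Disjoint (disk (.tri a) (position c ⟨.tri a, m⟩)) (disk .quad (position c ⟨.quad, k⟩)) := by
    refine disjoint_disk_tri_of_rank c m ⟨.quad, k⟩ fun j _ ↦ ?_
    have := m.2
    simp only [rank]
    omega
  have tri_tri (a : Fin 4) (m k : Fin (c (.tri a))) (h : m < k) :
      Disjoint (disk (.tri a) (position c ⟨.tri a, m⟩))
        (disk (.tri a) (position c ⟨.tri a, k⟩)) := by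
    refine disjoint_disk_tri_of_rank c m ⟨.tri a, k⟩ fun j _ ↦ ?_
    simpa [rank] using h
  have quad_quad (m k : Fin (c .quad)) (h : m < k) :
      Disjoint (disk .quad (position c ⟨.quad, m⟩)) (disk .quad (position c ⟨.quad, k⟩)) := by
    refine disjoint_disk_quad (isPosition_position _ _) (isPosition_position _ _) fun i j hi hj ↦ ?_
    have hc : Crosses .quad i j := by simp [Crosses, hi, hj]
    refine position_lt c (d := ⟨.quad, m⟩) (e := ⟨.quad, k⟩) hc hc ?_
    simpa [rank, hi] using h
  obtain ⟨a | _, m⟩ := d <;> obtain ⟨b | _, k⟩ := e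
  · by_cases hab : a = b
    · subst hab
      rcases lt_trichotomy m k with h | h | h
      · exact tri_tri a m k h
      · exact absurd (by rw [h]) hde
      · exact (tri_tri a k m h).symm
    · refine disjoint_disk_tri_of_rank c m ⟨.tri b, k⟩ fun j hj ↦ ?_
      obtain ⟨-, h | h⟩ := hj
      · exact absurd h hab
      · subst h
        simp only [rank, if_neg hab, weight_eq c hab]
        have := m.2
        have := k.2
        omega
  · exact tri_quad a m k
  · exact (tri_quad b k m).symm
  · rcases lt_trichotomy m k with h | h | h
    · exact quad_quad m k h
    · exact absurd (by rw [h]) hde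
    · exact (quad_quad k m h).symm

/-- With `exists_hasArc_rank`: the arcs at `i` in a face occupy exactly the ranks below `numArcs c f
i`, with the same rank on both edges. Across a face an arc can therefore be matched by rank alone,
whatever the disk types are. -/
theorem HasArc.exists_rank {c : DiskType → ℕ} {d : (t : DiskType) × Fin (c t)} {f i : Fin 4}
    (h : HasArc d.1 f i) : ∃ m < numArcs c f i, ∀ l, rank c d i l = m := by
  have hif := h.ne
  rw [numArcs_eq c hif]
  obtain ⟨a | _, m⟩ := d
  · obtain ⟨rfl, -⟩ := h
    exact ⟨m, by have := m.2; omega, fun l ↦ by simp [rank]⟩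
  · refine ⟨c (.tri i) + if i < 2 then (m : ℕ) else c .quad - 1 - m, ?_, fun l ↦ rfl⟩
    rw [if_pos (show HasArc .quad f i from h)]
    have := m.2
    split_ifs <;> omega

theorem exists_hasArc_rank {c : DiskType → ℕ} {f i : Fin 4} (hif : i ≠ f) {m : ℕ}
    (hm : m < numArcs c f i) :
    ∃ d : (t : DiskType) × Fin (c t), HasArc d.1 f i ∧ ∀ l, rank c d i l = m := by
  rw [numArcs_eq c hif] at hm
  by_cases h : m < c (.tri i)
  · exact ⟨⟨.tri i, ⟨m, h⟩⟩, ⟨rfl, hif⟩, fun l ↦ by simp [rank]⟩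
  · split_ifs at hm with hq
    · by_cases hi : i < 2
      · refine ⟨⟨.quad, ⟨m - c (.tri i), by omega⟩⟩, hq, fun l ↦ ?_⟩
        simp only [rank, if_pos hi]
        omega
      · refine ⟨⟨.quad, ⟨c .quad - 1 - (m - c (.tri i)), by omega⟩⟩, hq, fun l ↦ ?_⟩
        simp only [rank, if_neg hi]
        omega
    · omega

namespace FaceGluing

theorem vert_injective (𝒯 : FaceGluing n) (T : Fin n) (f : Fin 4) :
    Function.Injective (𝒯.vert T f) :=
  Function.LeftInverse.injective (𝒯.vert_vert T f)

theorem Glued.symm {𝒯 : FaceGluing n} {a b : Fin n × stdSimplex ℝ (Fin 4)} (h : 𝒯.Glued a b) :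
    𝒯.Glued b a := by
  obtain ⟨T, x⟩ := a
  obtain ⟨T', y⟩ := b
  obtain ⟨f, hf, hT, hxy⟩ := h
  dsimp only at hf hT hxy
  subst hT
  refine ⟨𝒯.vert T f f, by rw [hxy, hf], (𝒯.tet_tet T f).symm, fun i ↦ ?_⟩
  obtain ⟨k, rfl⟩ := Finite.surjective_of_injective (𝒯.vert_injective T f) i
  dsimp only
  rw [𝒯.vert_vert, hxy]

theorem Matching.weight_eq {𝒯 : FaceGluing n} {c : NormalCoord n} (h : 𝒯.Matching c) {T : Fin n}
    {f i j : Fin 4} (hi : i ≠ f) (hj : j ≠ f) (hij : i ≠ j) :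
    weight (c T) i j = weight (c (𝒯.tet T f)) (𝒯.vert T f i) (𝒯.vert T f j) := by
  have inj := 𝒯.vert_injective T f
  rw [weight_eq_add _ hij hi.symm hj.symm, weight_eq_add _ (inj.ne hij) (inj.ne hi.symm)
    (inj.ne hj.symm), h T f i hi, h T f j hj]

/-- The union of the evenly spaced elementary disks in the tetrahedron `a.1` contains `a.2`. -/
def MemDisks (c : NormalCoord n) (a : Fin n × stdSimplex ℝ (Fin 4)) : Prop :=
  ∃ d, (a.2 : Fin 4 → ℝ) ∈ disk d.1 (position (c a.1) d)

theorem Matching.memDisks_of_glued {𝒯 : FaceGluing n} {c : NormalCoord n} (h : 𝒯.Matching c)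
    {a b : Fin n × stdSimplex ℝ (Fin 4)} (hab : 𝒯.Glued a b) (ha : MemDisks c a) :
    MemDisks c b := by
  obtain ⟨T, x⟩ := a
  obtain ⟨T', y⟩ := b
  obtain ⟨f, hf, hT, hxy⟩ := hab
  obtain ⟨d, hd⟩ := ha
  dsimp only at hf hT hxy d hd
  subst hT
  replace hf : x.1 f = 0 := hf
  replace hxy : ∀ i, y.1 (𝒯.vert T f i) = x.1 i := hxy
  have inj := 𝒯.vert_injective T f
  obtain ⟨i, hi, hcut⟩ := (mem_disk_face_iff (isPosition_position _ d) d.1 x.2 hf).1 hd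
  obtain ⟨m, hm, hrank⟩ := hi.exists_rank
  rw [h T f i hi.ne] at hm
  obtain ⟨e, he, hrank'⟩ := exists_hasArc_rank (inj.ne hi.ne) hm
  refine ⟨e, (mem_disk_face_iff (isPosition_position _ e) e.1 y.2 (by rw [hxy, hf])).2
    ⟨_, he, ?_⟩⟩
  -- The two linear forms agree term by term: positions depend only on ranks and weights, which
  -- correspond under the gluing. The coefficients at `f` may differ, but the coordinate there is 0.
  rw [← hcut, cut_apply_ite, cut_apply_ite]
  symm
  refine Fintype.sum_bijective (𝒯.vert T f) (Finite.injective_iff_bijective.1 inj) _ _ fun l ↦ ?_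
  by_cases hl : l = i
  · rw [if_pos hl, if_pos (by rw [hl])]
  rw [if_neg hl, if_neg (inj.ne hl), hxy l]
  by_cases hlf : l = f
  · rw [hlf, hf, mul_zero, mul_zero]
  · rw [position, position, if_pos (hi.crosses hl hlf),
      if_pos (he.crosses (inj.ne hl) (inj.ne hlf)), hrank, hrank',
      h.weight_eq hi.ne hlf (Ne.symm hl)]

/-- Solutions of the matching equations are realized by normal surfaces. -/
theorem Matching.exists_isNormalSurface {𝒯 : FaceGluing n} {c : NormalCoord n}
    (h : 𝒯.Matching c) : ∃ S, IsNormalSurface 𝒯 c S := by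
  refine ⟨{q | Quot.lift (MemDisks c) (fun a b hab ↦ propext
    ⟨h.memDisks_of_glued hab, h.memDisks_of_glued hab.symm⟩) q}, fun T ↦
    ⟨fun d ↦ disk d.1 (position (c T) d), fun d ↦ isElementaryDisk_disk (isPosition_position _ d) d.1,
      fun d e hde ↦ disjoint_disk_position (c T) hde, fun x ↦ Iff.rfl⟩⟩

end FaceGluing

end NormalSurfaces

/-! ### The m-th element of a finite set -/

namespace NormalSurfaces

open Finset unitInterval

section Nth

variable {α : Type*} [LinearOrder α]

/-- `s` is the element of `E` with exactly `m` smaller elements. -/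
def IsNth (E : Set α) (m : ℕ) (s : α) : Prop := s ∈ E ∧ (E ∩ Set.Iio s).ncard = m

theorem ncard_inter_Iio_lt {E : Set α} (hE : E.Finite) {s t : α} (hs : s ∈ E) (h : s < t) :
    (E ∩ Set.Iio s).ncard < (E ∩ Set.Iio t).ncard := by
  refine Set.ncard_lt_ncard ⟨Set.inter_subset_inter_right _ (Set.Iio_subset_Iio h.le), fun hsub ↦ ?_⟩
    (hE.subset Set.inter_subset_left)
  exact lt_irrefl s (hsub ⟨hs, h⟩).2

theorem IsNth.unique {E : Set α} (hE : E.Finite) {m : ℕ} {s t : α} (hs : IsNth E m s)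
    (ht : IsNth E m t) : s = t := by
  rcases lt_trichotomy s t with h | h | h
  · have := ncard_inter_Iio_lt hE hs.1 h
    rw [hs.2, ht.2] at this
    exact absurd this (lt_irrefl m)
  · exact h
  · have := ncard_inter_Iio_lt hE ht.1 h
    rw [hs.2, ht.2] at this
    exact absurd this (lt_irrefl m)

theorem exists_isNth {E : Set α} (hE : E.Finite) {m : ℕ} (hm : m < E.ncard) :
    ∃ s, IsNth E m s := by
  classical
  have hcard : hE.toFinset.card = E.ncard := (Set.ncard_eq_toFinset_card E hE).symm
  let g := hE.toFinset.orderEmbOfFin hcard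
  have hg : Set.range g = E := by
    rw [Finset.range_orderEmbOfFin]
    simp
  refine ⟨g ⟨m, hm⟩, hg.subset (Set.mem_range_self _), ?_⟩
  have : E ∩ Set.Iio (g ⟨m, hm⟩) = g '' Set.Iio ⟨m, hm⟩ := by
    ext s
    simp only [← hg, Set.mem_inter_iff, Set.mem_range, Set.mem_Iio, Set.mem_image]
    constructor
    · rintro ⟨⟨k, rfl⟩, h⟩
      exact ⟨k, g.lt_iff_lt.1 h, rfl⟩
    · rintro ⟨k, h, rfl⟩
      exact ⟨⟨k, rfl⟩, g.lt_iff_lt.2 h⟩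
  rw [this, Set.ncard_image_of_injective _ g.injective, ← Finset.coe_Iio, Set.ncard_coe_finset]
  simp

theorem IsNth.lt_ncard {E : Set α} (hE : E.Finite) {m : ℕ} {s : α} (hs : IsNth E m s) :
    m < E.ncard := by
  rw [← hs.2]
  refine Set.ncard_lt_ncard ⟨Set.inter_subset_left, fun hsub ↦ ?_⟩ hE
  exact lt_irrefl s (hsub hs.1).2

/-- Two finite sets that start with images of the same family in the same order. -/
theorem IsNth.exists_of_lt {β ι : Type*} [LinearOrder β] [Finite ι] {A B B' : Set ι} {x : ι → α}
    {y : ι → β} (hx : Set.InjOn x A) (hy : Set.InjOn y A)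
    (hxy : ∀ d ∈ A, ∀ e ∈ A, x d < x e ↔ y d < y e)
    (hxB : ∀ d ∈ A, ∀ e ∈ B, x d < x e) (hyB : ∀ d ∈ A, ∀ e ∈ B', y d < y e)
    {m : ℕ} {s : α} (hs : IsNth (x '' (A ∪ B)) m s) (hm : m < A.ncard) :
    ∃ d ∈ A, s = x d ∧ IsNth (y '' (A ∪ B')) m (y d) := by
  obtain ⟨⟨d, hd, rfl⟩, hcard⟩ := hs
  have hdA : d ∈ A := by
    refine hd.resolve_right fun hdB ↦ hm.not_ge ?_
    rw [← hcard, ← hx.ncard_image]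
    refine Set.ncard_le_ncard ?_ (Set.toFinite _)
    rintro _ ⟨e, he, rfl⟩
    exact ⟨⟨e, Or.inl he, rfl⟩, hxB e he d hdB⟩
  refine ⟨d, hdA, rfl, ⟨d, Or.inl hdA, rfl⟩, ?_⟩
  have h1 : x '' (A ∪ B) ∩ Set.Iio (x d) = x '' {e ∈ A | x e < x d} := by
    ext s
    constructor
    · rintro ⟨⟨e, he, rfl⟩, h⟩
      exact ⟨e, ⟨he.resolve_right fun heB ↦ lt_asymm h (hxB d hdA e heB), h⟩, rfl⟩
    · rintro ⟨e, ⟨he, h⟩, rfl⟩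
      exact ⟨⟨e, Or.inl he, rfl⟩, h⟩
  have h2 : y '' (A ∪ B') ∩ Set.Iio (y d) = y '' {e ∈ A | x e < x d} := by
    ext s
    constructor
    · rintro ⟨⟨e, he, rfl⟩, h⟩
      have heA := he.resolve_right fun heB ↦ lt_asymm h (hyB d hdA e heB)
      exact ⟨e, ⟨heA, (hxy e heA d hdA).2 h⟩, rfl⟩
    · rintro ⟨e, ⟨he, h⟩, rfl⟩
      exact ⟨⟨e, Or.inl he, rfl⟩, (hxy e he d hdA).1 h⟩
  rw [h1, (hx.mono (Set.sep_subset _ _)).ncard_image] at hcard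
  rw [h2, (hy.mono (Set.sep_subset _ _)).ncard_image, hcard]

theorem IsNth.symm_preimage {E : Set I} (hE : E.Finite) {m m' : ℕ} {s : I} (hs : IsNth E m s)
    (h : m + m' + 1 = E.ncard) : IsNth (σ ⁻¹' E) m' (σ s) := by
  refine ⟨by simpa using hs.1, ?_⟩
  have h1 : σ ⁻¹' E ∩ Set.Iio (σ s) = σ '' (E ∩ Set.Ioi s) := by
    ext t
    simp only [Set.mem_inter_iff, Set.mem_preimage, Set.mem_Iio, Set.mem_image, Set.mem_Ioi]
    constructor
    · rintro ⟨ht, hlt⟩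
      exact ⟨σ t, ⟨ht, by rwa [← symm_lt_symm, symm_symm]⟩, symm_symm t⟩
    · rintro ⟨r, ⟨hr, hlt⟩, rfl⟩
      exact ⟨by simpa using hr, symm_lt_symm.2 hlt⟩
  rw [h1, Set.ncard_image_of_injective _ symm_bijective.injective]
  have h2 : E = insert s (E ∩ Set.Iio s ∪ E ∩ Set.Ioi s) := by
    ext t
    simp only [Set.mem_insert_iff, Set.mem_union, Set.mem_inter_iff, Set.mem_Iio, Set.mem_Ioi]
    constructor
    · intro ht
      rcases lt_trichotomy t s with h | h | h
      · exact Or.inr (Or.inl ⟨ht, h⟩)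
      · exact Or.inl h
      · exact Or.inr (Or.inr ⟨ht, h⟩)
    · rintro (rfl | ⟨h, -⟩ | ⟨h, -⟩)
      exacts [hs.1, h, h]
  have h3 : E.ncard = (E ∩ Set.Iio s).ncard + (E ∩ Set.Ioi s).ncard + 1 := by
    conv_lhs => rw [h2]
    rw [Set.ncard_insert_of_notMem (by simp) ((hE.subset Set.inter_subset_left).union
      (hE.subset Set.inter_subset_left)), Set.ncard_union_eq ?_ (hE.subset Set.inter_subset_left)
      (hE.subset Set.inter_subset_left)]
    rw [Set.disjoint_left]
    rintro t ⟨-, h⟩ ⟨-, h'⟩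
    exact lt_asymm (Set.mem_Iio.1 h) (Set.mem_Ioi.1 h')
  rw [hs.2] at h3
  omega

end Nth

theorem ncard_disks (c : DiskType → ℕ) (P : DiskType → Prop) [DecidablePred P] :
    {d : (t : DiskType) × Fin (c t) | P d.1}.ncard = ∑ t with P t, c t := by
  have : {d : (t : DiskType) × Fin (c t) | P d.1} =
      ((univ.filter P).sigma fun t ↦ (univ : Finset (Fin (c t)))) := by
    ext d
    simp
  rw [this, Set.ncard_coe_finset, card_sigma]
  simp

/-! ### Disjoint arcs in a face do not cross -/

section Geometry

/-- Two segments across the same corner of a triangle, with their ends in opposite orders on the two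
sides, intersect. The parameters of the intersection come from Cramer's rule. -/
theorem exists_crossing {a b a' b' : ℝ} (ha : 0 < a) (haa : a < a') (hb' : 0 < b') (hbb : b' ≤ b) :
    ∃ x ∈ I, ∃ y ∈ I, (1 - x) * a = (1 - y) * a' ∧ x * b = y * b' := by
  have hd : 0 < a' * b - a * b' := by nlinarith
  refine ⟨(a' - a) * b' / (a' * b - a * b'), ⟨?_, ?_⟩, (a' - a) * b / (a' * b - a * b'), ⟨?_, ?_⟩,
    ?_, ?_⟩
  · exact div_nonneg (mul_nonneg (by linarith) hb'.le) hd.le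
  · rw [div_le_one hd]; nlinarith
  · exact div_nonneg (mul_nonneg (by linarith) (by linarith)) hd.le
  · rw [div_le_one hd]; nlinarith
  · field_simp; ring
  · field_simp

/-- The same for segments across two different corners: `a` and `a'` are measured from the two ends
of the common side, and `1 ≤ a + a'` says that the segments overlap there. -/
theorem exists_crossing_of_one_le {a b a' b' : ℝ} (ha' : 0 < a') (ha'' : a' < 1) (hb : 0 < b)
    (hb1 : b < 1) (hb' : 0 < b') (hb1' : b' < 1) (ha : a < 1) (h : 1 ≤ a + a') :
    ∃ x ∈ I, ∃ y ∈ I, (1 - x) * a = (1 - y) * (1 - a') + y * (1 - b') ∧ x * b = y * b' := by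
  have e1 : 0 < a' * b * (1 - b') := mul_pos (mul_pos ha' hb) (by linarith)
  have e2 : 0 < b' * (1 - a') * (1 - b) :=
    mul_pos (mul_pos hb' (by linarith)) (by linarith)
  have e3 : 0 ≤ (a + a' - 1) * b' := mul_nonneg (by linarith) hb'.le
  have e4 : 0 ≤ (a + a' - 1) * b := mul_nonneg (by linarith) hb.le
  have e5 : 0 < a * b' * (1 - b) := mul_pos (mul_pos (by linarith) hb') (by linarith)
  have e6 : 0 < b * (1 - a) * (1 - b') := mul_pos (mul_pos hb (by linarith)) (by linarith)
  have hd : 0 < a * b' + a' * b - b * b' := by nlinarith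
  obtain ⟨r, hr⟩ : ∃ r, r = a * b' + a' * b - b * b' := ⟨_, rfl⟩
  rw [← hr] at hd
  refine ⟨(a + a' - 1) * b' / r, ⟨?_, ?_⟩, (a + a' - 1) * b / r, ⟨?_, ?_⟩, ?_, ?_⟩
  · exact div_nonneg e3 hd.le
  · rw [div_le_one hd]; nlinarith
  · exact div_nonneg e4 hd.le
  · rw [div_le_one hd]; nlinarith
  · field_simp
    linear_combination (a + a' - 1) * hr
  · field_simp

theorem exists_ne_ne (i j : Fin 4) : ∃ f, f ≠ i ∧ f ≠ j := by
  revert i j; decide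

theorem exists_ne_ne_ne (i j f : Fin 4) : ∃ k, k ≠ i ∧ k ≠ j ∧ k ≠ f := by
  revert i j f; decide

theorem edgePoint_mem_disk_iff {p : Fin 4 → Fin 4 → ℝ} (hp : IsPosition p) (t : DiskType)
    {i j : Fin 4} (hij : i ≠ j) {s : ℝ} (hs : s ∈ I) :
    edgePoint i j s ∈ disk t p ↔ Crosses t i j ∧ s = p i j := by
  obtain ⟨f, hfi, hfj⟩ := exists_ne_ne i j
  have hx := edgePoint_mem_stdSimplex i j hs
  have hzero (k : Fin 4) (hi : k ≠ i) (hj : k ≠ j) : edgePoint i j s k = 0 := by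
    simp [edgePoint_apply, hi, hj]
  have hleft : cut p i (edgePoint i j s) = 1 ↔ s = p i j := by
    rw [cut_edgePoint_left p hij.symm, inv_mul_eq_one₀ (hp.pos i j).ne', eq_comm]
  have hright : cut p j (edgePoint i j s) = 1 ↔ s = p i j := by
    rw [cut_edgePoint_right p hij, inv_mul_eq_one₀ (hp.pos j i).ne', hp.symm i j]
    constructor <;> intro h <;> linarith
  rw [mem_disk_face_iff hp t hx (hzero f hfi hfj), crosses_iff_hasArc hij hfi hfj]
  constructor
  · rintro ⟨k, hk, hcut⟩
    by_cases hki : k = i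
    · subst hki
      exact ⟨Or.inl hk, hleft.1 hcut⟩
    by_cases hkj : k = j
    · subst hkj
      exact ⟨Or.inr hk, hright.1 hcut⟩
    exact absurd hcut (one_lt_cut hp hx (hzero k hki hkj)).ne'
  · rintro ⟨h | h, hs⟩
    · exact ⟨i, h, hleft.2 hs⟩
    · exact ⟨j, h, hright.2 hs⟩

theorem segment_subset_disk {p : Fin 4 → Fin 4 → ℝ} (hp : IsPosition p) {t : DiskType}
    {f i j k : Fin 4} (h : HasArc t f i) (hji : j ≠ i) (hjf : j ≠ f) (hki : k ≠ i) (hkf : k ≠ f) :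
    segment ℝ (edgePoint i j (p i j)) (edgePoint i k (p i k)) ⊆ disk t p := by
  have hmem (l : Fin 4) (hli : l ≠ i) (hlf : l ≠ f) : edgePoint i l (p i l) ∈
      stdSimplex ℝ (Fin 4) ∩ ({x | LinearMap.proj (R := ℝ) (φ := fun _ : Fin 4 ↦ ℝ) f x = 0} ∩
        {x | cut p i x = 1}) := by
    refine ⟨edgePoint_mem_stdSimplex i l ⟨(hp.pos i l).le, (hp.lt_one i l).le⟩, ?_, ?_⟩
    · change edgePoint i l (p i l) f = 0
      simp [edgePoint_apply, h.ne.symm, hlf.symm]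
    · change cut p i _ = 1
      rw [cut_edgePoint_left p hli, inv_mul_cancel₀ (hp.pos i l).ne']
  have hconv := (convex_stdSimplex ℝ (Fin 4)).inter
    ((convex_hyperplane (LinearMap.proj (R := ℝ) (φ := fun _ : Fin 4 ↦ ℝ) f).isLinear 0).inter
      (convex_hyperplane (cut p i).isLinear 1))
  intro x hx
  obtain ⟨h1, h2, h3⟩ := hconv.segment_subset (hmem j hji hjf) (hmem k hki hkf) hx
  exact (mem_disk_face_iff hp t h1 h2).2 ⟨i, h, h3⟩

/-- Disjoint arcs at the same vertex of a face are in the same order on both edges. -/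
theorem position_lt_of_disjoint {p q : Fin 4 → Fin 4 → ℝ} (hp : IsPosition p) (hq : IsPosition q)
    {t t' : DiskType} (hdisj : Disjoint (disk t p) (disk t' q)) {f i j k : Fin 4}
    (h : HasArc t f i) (h' : HasArc t' f i) (hji : j ≠ i) (hjf : j ≠ f) (hki : k ≠ i) (hkf : k ≠ f)
    (hlt : p i j < q i j) : p i k < q i k := by
  by_contra! hle
  obtain ⟨x, hx, y, hy, e1, e2⟩ := exists_crossing (hp.pos i j) hlt (hq.pos i k) hle
  refine Set.disjoint_left.1 hdisj (segment_subset_disk hp h hji hjf hki hkf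
    ⟨1 - x, x, by linarith [hx.2], hx.1, by ring, rfl⟩) ?_
  refine segment_subset_disk hq h' hji hjf hki hkf
    ⟨1 - y, y, by linarith [hy.2], hy.1, by ring, ?_⟩
  ext l
  simp only [Pi.add_apply, Pi.smul_apply, smul_eq_mul, edgePoint_apply]
  linear_combination ((if l = i then (1 : ℝ) else 0) - (if l = j then (1 : ℝ) else 0)) * e1 +
    ((if l = i then (1 : ℝ) else 0) - (if l = k then (1 : ℝ) else 0)) * e2

/-- Disjoint arcs at different vertices of a face are in the obvious order on the common edge. -/
theorem position_lt_of_disjoint_of_ne {p q : Fin 4 → Fin 4 → ℝ} (hp : IsPosition p)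
    (hq : IsPosition q) {t t' : DiskType} (hdisj : Disjoint (disk t p) (disk t' q))
    {f i j : Fin 4} (h : HasArc t f i) (h' : HasArc t' f j) (hij : i ≠ j) : p i j < q i j := by
  obtain ⟨k, hki, hkj, hkf⟩ : ∃ k, k ≠ i ∧ k ≠ j ∧ k ≠ f :=
    exists_ne_ne_ne i j f
  by_contra! hle
  obtain ⟨x, hx, y, hy, e1, e2⟩ := exists_crossing_of_one_le (hq.pos j i) (hq.lt_one j i)
    (hp.pos i k) (hp.lt_one i k) (hq.pos j k) (hq.lt_one j k) (hp.lt_one i j)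
    (by linarith [hq.symm i j])
  refine Set.disjoint_left.1 hdisj (segment_subset_disk hp h hij.symm h'.ne hki hkf
    ⟨1 - x, x, by linarith [hx.2], hx.1, by ring, rfl⟩) ?_
  refine segment_subset_disk hq h' hij h.ne hkj hkf
    ⟨1 - y, y, by linarith [hy.2], hy.1, by ring, ?_⟩
  ext l
  simp only [Pi.add_apply, Pi.smul_apply, smul_eq_mul, edgePoint_apply]
  linear_combination ((if l = i then (1 : ℝ) else 0) - (if l = j then (1 : ℝ) else 0)) * e1 +
    ((if l = i then (1 : ℝ) else 0) - (if l = k then (1 : ℝ) else 0)) * e2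

/-- Every point of a disk is connected to some corner by a segment in the disk. -/
theorem exists_segment_subset_disk {t : DiskType} {p : Fin 4 → Fin 4 → ℝ} {x : Fin 4 → ℝ}
    (hx : x ∈ disk t p) :
    ∃ i j, Crosses t i j ∧ segment ℝ x (edgePoint i j (p i j)) ⊆ disk t p := by
  cases t with
  | tri i =>
    obtain ⟨j, hj, -⟩ := exists_ne_ne i i
    exact ⟨i, j, ⟨hj.symm, Or.inl rfl⟩, (convex_convexHull ℝ _).segment_subset hx
      (subset_convexHull ℝ _ ⟨j, hj, rfl⟩)⟩
  | quad =>
    obtain ⟨k, hk⟩ := Set.mem_iUnion.1 hx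
    obtain ⟨i, j, hij, h⟩ := quadCorner_mem_corners p k
    refine ⟨i, j, hij, ?_⟩
    rw [← h]
    exact ((convex_convexHull ℝ _).segment_subset hk (subset_convexHull ℝ _ (by simp))).trans
      (Set.subset_iUnion (fun k : Fin 4 ↦ convexHull ℝ
        {(1 / 4 : ℝ) • ∑ l, quadCorner p l, quadCorner p k, quadCorner p (k + 1)}) k)

end Geometry

end NormalSurfaces

/-! ### Points of a normal surface on the edges, and their connection by arcs -/

namespace NormalSurfaces

open Finset unitInterval

variable {n : ℕ} {𝒯 : FaceGluing n} {c : NormalCoord n} {S : Set 𝒯.Space}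

/-- The edge `ij` as a path in the standard tetrahedron. -/
noncomputable def edgeMap (i j : Fin 4) (s : I) : stdSimplex ℝ (Fin 4) :=
  ⟨edgePoint i j s, edgePoint_mem_stdSimplex i j s.2⟩

theorem edgeMap_symm (i j : Fin 4) (s : I) : edgeMap j i s = edgeMap i j (σ s) :=
  Subtype.ext (edgePoint_symm j i s)

theorem FaceGluing.charMap_edgeMap (𝒯 : FaceGluing n) (T : Fin n) {f i j : Fin 4} (hi : i ≠ f)
    (hj : j ≠ f) (s : I) : 𝒯.charMap (𝒯.tet T f) (edgeMap (𝒯.vert T f i) (𝒯.vert T f j) s) =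
      𝒯.charMap T (edgeMap i j s) := by
  refine (Quot.sound ⟨f, ?_, rfl, fun l ↦ ?_⟩).symm
  · change edgePoint i j s f = 0
    simp [edgePoint_apply, hi.symm, hj.symm]
  · change edgePoint _ _ (s : ℝ) _ = edgePoint i j s l
    simp only [edgePoint_apply, (𝒯.vert_injective T f).eq_iff]

theorem FaceGluing.continuous_charMap (𝒯 : FaceGluing n) (T : Fin n) :
    Continuous (𝒯.charMap T) :=
  continuous_quot_mk.comp (Continuous.prodMk_right T)

/-- The parameters of the points of `S` on the edge `ij` of the tetrahedron `T`. -/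
def edgeSet (S : Set 𝒯.Space) (T : Fin n) (i j : Fin 4) : Set I :=
  {s | 𝒯.charMap T (edgeMap i j s) ∈ S}

/-- The point of `S` on the edge `ij` of the tetrahedron `T` that is separated from the vertex `i` by
`m` other ones. -/
noncomputable def edgeNth (S : Set 𝒯.Space) (T : Fin n) (i j : Fin 4) (m : ℕ) : 𝒯.Space :=
  𝒯.charMap T (edgeMap i j (Classical.epsilon (IsNth (edgeSet S T i j) m)))

theorem edgeSet_glue (S : Set 𝒯.Space) (T : Fin n) {f i j : Fin 4} (hi : i ≠ f) (hj : j ≠ f) :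
    edgeSet S (𝒯.tet T f) (𝒯.vert T f i) (𝒯.vert T f j) = edgeSet S T i j := by
  ext s
  change _ ∈ S ↔ _ ∈ S
  rw [𝒯.charMap_edgeMap T hi hj s]

theorem edgeNth_glue (S : Set 𝒯.Space) (T : Fin n) {f i j : Fin 4} (hi : i ≠ f) (hj : j ≠ f)
    (m : ℕ) : edgeNth S (𝒯.tet T f) (𝒯.vert T f i) (𝒯.vert T f j) m = edgeNth S T i j m := by
  rw [edgeNth, edgeSet_glue S T hi hj, 𝒯.charMap_edgeMap T hi hj, edgeNth]

theorem edgeNth_eq {T : Fin n} {i j : Fin 4} (hfin : (edgeSet S T i j).Finite) {m : ℕ} {s : I}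
    (h : IsNth (edgeSet S T i j) m s) : edgeNth S T i j m = 𝒯.charMap T (edgeMap i j s) := by
  rw [edgeNth, IsNth.unique hfin (Classical.epsilon_spec ⟨s, h⟩) h]

theorem edgeSet_symm (S : Set 𝒯.Space) (T : Fin n) (i j : Fin 4) :
    edgeSet S T j i = σ ⁻¹' edgeSet S T i j := by
  ext s
  simp only [edgeSet, edgeMap_symm i j]
  rfl

theorem IsNormalSurface.exists_position (hS : IsNormalSurface 𝒯 c S) (T : Fin n) :
    ∃ p : ((t : DiskType) × Fin (c T t)) → Fin 4 → Fin 4 → ℝ, (∀ d, IsPosition (p d)) ∧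
      (∀ d e, d ≠ e → Disjoint (disk d.1 (p d)) (disk e.1 (p e))) ∧
      ∀ x : stdSimplex ℝ (Fin 4), 𝒯.charMap T x ∈ S ↔ ∃ d, x.1 ∈ disk d.1 (p d) := by
  obtain ⟨D, hD, hdisj, hmem⟩ := hS T
  choose p hp hDp using fun d ↦ (hD d).exists_eq_disk
  refine ⟨p, hp, fun d e hde ↦ ?_, fun x ↦ ?_⟩
  · rw [← hDp, ← hDp]
    exact hdisj d e hde
  · simp only [← hDp]
    exact hmem x

/-- A position as a point of the unit interval. -/
def IsPosition.toI {p : Fin 4 → Fin 4 → ℝ} (hp : IsPosition p) (i j : Fin 4) : I :=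
  ⟨p i j, (hp.pos i j).le, (hp.lt_one i j).le⟩

section Positions

variable {T : Fin n} {p : ((t : DiskType) × Fin (c T t)) → Fin 4 → Fin 4 → ℝ}

theorem edgeSet_eq_image (hp : ∀ d, IsPosition (p d))
    (hmem : ∀ x : stdSimplex ℝ (Fin 4), 𝒯.charMap T x ∈ S ↔ ∃ d, x.1 ∈ disk d.1 (p d))
    {i j : Fin 4} (hij : i ≠ j) :
    edgeSet S T i j = (fun d ↦ (hp d).toI i j) '' {d | Crosses d.1 i j} := by
  ext s
  refine (hmem _).trans (exists_congr fun d ↦ ?_)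
  refine (edgePoint_mem_disk_iff (hp d) d.1 hij s.2).trans (and_congr_right fun _ ↦ ?_)
  rw [eq_comm, Subtype.ext_iff]
  rfl

theorem injOn_toI (hp : ∀ d, IsPosition (p d))
    (hdisj : ∀ d e, d ≠ e → Disjoint (disk d.1 (p d)) (disk e.1 (p e)))
    {i j : Fin 4} (hij : i ≠ j) :
    Set.InjOn (fun d ↦ (hp d).toI i j) {d | Crosses d.1 i j} := by
  intro d hd e he hde
  by_contra hne
  have h : p d i j = p e i j := congrArg Subtype.val hde
  have hI : p d i j ∈ I := ((hp d).toI i j).2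
  refine Set.disjoint_left.1 (hdisj d e hne)
    ((edgePoint_mem_disk_iff (hp d) d.1 hij hI).2 ⟨hd, rfl⟩)
    ((edgePoint_mem_disk_iff (hp e) e.1 hij hI).2 ⟨he, h⟩)

end Positions

theorem IsNormalSurface.finite_edgeSet (hS : IsNormalSurface 𝒯 c S) (T : Fin n) {i j : Fin 4}
    (hij : i ≠ j) : (edgeSet S T i j).Finite := by
  obtain ⟨p, hp, -, hmem⟩ := hS.exists_position T
  rw [edgeSet_eq_image hp hmem hij]
  exact Set.toFinite _

theorem IsNormalSurface.ncard_edgeSet (hS : IsNormalSurface 𝒯 c S) (T : Fin n) {i j : Fin 4}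
    (hij : i ≠ j) : (edgeSet S T i j).ncard = weight (c T) i j := by
  obtain ⟨p, hp, hdisj, hmem⟩ := hS.exists_position T
  rw [edgeSet_eq_image hp hmem hij, (injOn_toI hp hdisj hij).ncard_image,
    ncard_disks (c T) (fun t ↦ Crosses t i j), weight]

theorem IsNormalSurface.exists_isNth (hS : IsNormalSurface 𝒯 c S) (T : Fin n) {i j : Fin 4}
    (hij : i ≠ j) {m : ℕ} (hm : m < weight (c T) i j) : ∃ s, IsNth (edgeSet S T i j) m s :=
  NormalSurfaces.exists_isNth (hS.finite_edgeSet T hij) (by rwa [hS.ncard_edgeSet T hij])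

/-- Counting the points on an edge from its other end. -/
theorem IsNormalSurface.edgeNth_rev (hS : IsNormalSurface 𝒯 c S) (T : Fin n) {i j : Fin 4}
    (hij : i ≠ j) {m m' : ℕ} (h : m + m' + 1 = weight (c T) i j) :
    edgeNth S T i j m = edgeNth S T j i m' := by
  obtain ⟨s, hs⟩ := hS.exists_isNth T hij (m := m) (by omega)
  have hs' := hs.symm_preimage (hS.finite_edgeSet T hij) (h.trans (hS.ncard_edgeSet T hij).symm)
  rw [← edgeSet_symm] at hs'
  rw [edgeNth_eq (hS.finite_edgeSet T hij) hs, edgeNth_eq (hS.finite_edgeSet T hij.symm) hs',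
    edgeMap_symm i j, symm_symm]

theorem joinedIn_charMap {T : Fin n} {D : Set (Fin 4 → ℝ)} (hD : D ⊆ stdSimplex ℝ (Fin 4))
    (hDS : ∀ x : stdSimplex ℝ (Fin 4), x.1 ∈ D → 𝒯.charMap T x ∈ S) {x y : stdSimplex ℝ (Fin 4)}
    (h : JoinedIn D x.1 y.1) : JoinedIn S (𝒯.charMap T x) (𝒯.charMap T y) := by
  obtain ⟨γ, hγ⟩ := h
  refine ⟨⟨⟨fun t ↦ 𝒯.charMap T ⟨γ t, hD (hγ t)⟩, (𝒯.continuous_charMap T).comp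
    (γ.continuous.subtype_mk _)⟩, ?_, ?_⟩, fun t ↦ hDS _ (hγ t)⟩
  · simp
  · simp

/-- The normal arcs connect the points on two edges of a face in their order. -/
theorem IsNormalSurface.joinedIn_edgeNth (hS : IsNormalSurface 𝒯 c S) (T : Fin n)
    {f i j k : Fin 4} (hji : j ≠ i) (hjf : j ≠ f) (hki : k ≠ i) (hkf : k ≠ f) (hif : i ≠ f)
    {m : ℕ} (hm : m < numArcs (c T) f i) :
    JoinedIn S (edgeNth S T i j m) (edgeNth S T i k m) := by
  obtain ⟨p, hp, hdisj, hmem⟩ := hS.exists_position T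
  have hunion (l : Fin 4) (hli : l ≠ i) (hlf : l ≠ f) :
      {d : (t : DiskType) × Fin (c T t) | Crosses d.1 i l} =
        {d | HasArc d.1 f i} ∪ {d | HasArc d.1 f l} := by
    ext d
    exact crosses_iff_hasArc hli.symm hif.symm hlf.symm
  have hinj (l : Fin 4) (hli : l ≠ i) (hlf : l ≠ f) :
      Set.InjOn (fun d ↦ (hp d).toI i l) {d | HasArc d.1 f i} :=
    (injOn_toI hp hdisj hli.symm).mono fun d hd ↦ HasArc.crosses hd hli hlf
  have hE (l : Fin 4) (hli : l ≠ i) (hlf : l ≠ f) := hunion l hli hlf ▸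
    edgeSet_eq_image hp hmem hli.symm
  have horder (l : Fin 4) (hli : l ≠ i) : ∀ d ∈ {d : (t : DiskType) × Fin (c T t) | HasArc d.1 f i},
      ∀ e ∈ {d : (t : DiskType) × Fin (c T t) | HasArc d.1 f l},
      (hp d).toI i l < (hp e).toI i l := by
    intro d hd e he
    have hde : d ≠ e := by
      rintro rfl
      exact hli (HasArc.unique he hd)
    exact position_lt_of_disjoint_of_ne (hp d) (hp e) (hdisj d e hde) hd he hli.symm
  have hmono (d e : (t : DiskType) × Fin (c T t)) (hd : HasArc d.1 f i) (he : HasArc e.1 f i)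
      (l l' : Fin 4) (hli : l ≠ i) (hlf : l ≠ f) (hli' : l' ≠ i) (hlf' : l' ≠ f)
      (hlt : (hp d).toI i l < (hp e).toI i l) : (hp d).toI i l' < (hp e).toI i l' := by
    have hde : d ≠ e := by
      rintro rfl
      exact lt_irrefl _ hlt
    exact position_lt_of_disjoint (hp d) (hp e) (hdisj d e hde) hd he hli hlf hli' hlf' hlt
  have hw : numArcs (c T) f i ≤ weight (c T) i j := by
    rw [weight_eq_add _ hji.symm hif.symm hjf.symm]
    exact Nat.le_add_right _ _
  obtain ⟨s, hs⟩ := hS.exists_isNth T hji.symm (hm.trans_le hw)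
  have hs' := hs
  rw [hE j hji hjf] at hs'
  -- On both edges the arcs at `i` come before those at the other end, and in the same order. So the
  -- arc through the m-th point of one edge ends at the m-th point of the other.
  obtain ⟨d, hd, rfl, hnth⟩ := hs'.exists_of_lt (hinj j hji hjf) (hinj k hki hkf)
    (fun d hd e he ↦ ⟨hmono d e hd he j k hji hjf hki hkf, hmono d e hd he k j hki hkf hji hjf⟩)
    (horder j hji) (horder k hki) (by rwa [ncard_disks (c T) (fun t ↦ HasArc t f i)])
  rw [← hE k hki hkf] at hnth
  rw [edgeNth_eq (hS.finite_edgeSet T hji.symm) hs, edgeNth_eq (hS.finite_edgeSet T hki.symm) hnth]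
  exact joinedIn_charMap (disk_subset_stdSimplex (hp d) d.1) (fun x hx ↦ (hmem x).2 ⟨d, hx⟩)
    (JoinedIn.of_segment_subset (segment_subset_disk (hp d) hd hji hjf hki hkf))

/-- Every point of a normal surface is connected in it to a point on some edge. -/
theorem IsNormalSurface.exists_joinedIn_edgeNth (hS : IsNormalSurface 𝒯 c S) {q : 𝒯.Space}
    (hq : q ∈ S) :
    ∃ T i j m, i ≠ j ∧ m < weight (c T) i j ∧ JoinedIn S q (edgeNth S T i j m) := by
  obtain ⟨⟨T, x⟩, rfl⟩ := Quot.exists_rep q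
  obtain ⟨p, hp, hdisj, hmem⟩ := hS.exists_position T
  obtain ⟨d, hd⟩ := (hmem x).1 hq
  obtain ⟨i, j, hij, hseg⟩ := exists_segment_subset_disk hd
  have hfin := hS.finite_edgeSet T hij.ne
  have hnth : IsNth (edgeSet S T i j) (edgeSet S T i j ∩ Set.Iio ((hp d).toI i j)).ncard
      ((hp d).toI i j) := by
    refine ⟨?_, rfl⟩
    rw [edgeSet_eq_image hp hmem hij.ne]
    exact ⟨d, hij, rfl⟩
  refine ⟨T, i, j, _, hij.ne, hS.ncard_edgeSet T hij.ne ▸ hnth.lt_ncard hfin, ?_⟩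
  rw [edgeNth_eq hfin hnth]
  exact joinedIn_charMap (disk_subset_stdSimplex (hp d) d.1) (fun x hx ↦ (hmem x).2 ⟨d, hx⟩)
    (JoinedIn.of_segment_subset hseg)

end NormalSurfaces

/-! ### Transitivity of a reflection and a translation on a cycle -/

namespace NormalSurfaces

theorem rel_add_mul_of_rel_add {R : ℤ → ℤ → Prop} (hR : Equivalence R) {d : ℤ}
    (h : ∀ x, R x (x + d)) (x z : ℤ) : R x (x + d * z) := by
  induction z using Int.induction_on with
  | zero => simpa using hR.refl x
  | succ k ih =>
    refine hR.trans ih ?_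
    convert h (x + d * k) using 1
    ring
  | pred k ih =>
    refine hR.trans ih (hR.symm ?_)
    convert h (x + d * (-(k : ℤ) - 1)) using 1
    ring

/-- The action of a translation and a reflection on a cycle of length `2 * w` is transitive. -/
theorem rel_of_translation_of_reflection {R : ℤ → ℤ → Prop} (hR : Equivalence R) {u w : ℤ}
    (huw : IsCoprime u w) (hper : ∀ x, R x (x + 2 * w)) (htrans : ∀ x, R x (x + 2 * u))
    (hrefl : ∀ x, R x (2 * u - 1 - x)) (x y : ℤ) : R x y := by
  obtain ⟨s, t, hst⟩ := huw
  -- Bézout: 2 = 2us + 2wt.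
  have htwo (x : ℤ) : R x (x + 2) := by
    refine hR.trans (rel_add_mul_of_rel_add hR htrans x s) ?_
    convert rel_add_mul_of_rel_add hR hper (x + 2 * u * s) t using 1
    linear_combination (-2 : ℤ) * hst
  -- The reflection sends 0 to the odd number 2u - 1.
  have hodd : R 0 1 := by
    refine hR.trans (hrefl 0) (hR.symm ?_)
    convert rel_add_mul_of_rel_add hR htwo 1 (u - 1) using 1
    ring
  have hzero (x : ℤ) : R 0 x := by
    obtain ⟨k, rfl | rfl⟩ := Int.even_or_odd' x
    · simpa using rel_add_mul_of_rel_add hR htwo 0 k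
    · refine hR.trans hodd ?_
      convert rel_add_mul_of_rel_add hR htwo 1 k using 1
      ring
  exact hR.trans (hR.symm (hzero x)) (hzero y)

section Cycle

variable {X : Type*} {R : X → X → Prop} {a : ℕ → X} {u v : ℕ}

/-- A family indexed by `0, …, 2 * (u + v) - 1` is connected by the reflections of its first `2 * u`
and its last `2 * v` members and by the cyclic translation by `2 * u` of its first half. -/
theorem rel_of_reflections_of_translation (symm : ∀ {x y}, R x y → R y x)
    (trans : ∀ {x y z}, R x y → R y z → R x z) (huv : Nat.Coprime u v)
    (hfst : ∀ k l, k + l + 1 = 2 * u → R (a k) (a l))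
    (hsnd : ∀ k l, k + l + 1 = 2 * v → R (a (2 * u + k)) (a (2 * u + l)))
    (hlow : ∀ k, k < u + v → k < 2 * v → R (a k) (a (k + 2 * u)))
    (hhigh : ∀ k, k + 2 * v < u + v → R (a (k + 2 * v)) (a k))
    {k l : ℕ} (hk : k < 2 * (u + v)) (hl : l < 2 * (u + v)) : R (a k) (a l) := by
  have hN : 0 < 2 * (u + v) := by omega
  -- The family is continued periodically to ℤ, where the two block reflections become one formula.
  let ρ : ℤ → X := fun x ↦ a (x % (2 * (u + v) : ℕ)).toNat
  have hρ (k : ℕ) (hk : k < 2 * (u + v)) (z : ℤ) : ρ (k + 2 * (u + v) * z) = a k := by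
    have : ((k : ℤ) + 2 * (u + v) * z) % (2 * (u + v) : ℕ) = k := by
      push_cast
      rw [Int.add_mul_emod_self_left]
      exact Int.emod_eq_of_lt (by positivity) (by exact_mod_cast hk)
    simp only [ρ, this, Int.toNat_natCast]
  have hrep (x : ℤ) : ∃ k : ℕ, ∃ z : ℤ, k < 2 * (u + v) ∧ x = k + 2 * (u + v) * z := by
    have hpos : (0 : ℤ) < 2 * (u + v) := by exact_mod_cast hN
    have h0 := Int.emod_nonneg x hpos.ne'
    have h1 := Int.emod_lt_of_pos x hpos
    refine ⟨(x % (2 * (u + v))).toNat, x / (2 * (u + v)), by omega, ?_⟩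
    rw [Int.toNat_of_nonneg h0, Int.emod_add_mul_ediv]
  have hρ' (x z : ℤ) (k : ℕ) (hk : k < 2 * (u + v)) (hx : x = k + 2 * (u + v) * z) :
      ρ x = a k := hx ▸ hρ k hk z
  have hrefl (x : ℤ) : R (ρ x) (ρ (2 * u - 1 - x)) := by
    obtain ⟨k, z, hk, rfl⟩ := hrep x
    rw [hρ k hk]
    by_cases hku : k < 2 * u
    · rw [hρ' _ (-z) (2 * u - 1 - k) (by omega)]
      · exact hfst _ _ (by omega)
      · rw [Nat.cast_sub (by omega), Nat.cast_sub (by omega)]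
        push_cast
        ring
    · obtain ⟨m, rfl⟩ := Nat.exists_eq_add_of_le (not_lt.1 hku)
      rw [hρ' _ (-z - 1) (2 * u + (2 * v - 1 - m)) (by omega)]
      · exact hsnd _ _ (by omega)
      · rw [Nat.cast_add (2 * u) (2 * v - 1 - m), Nat.cast_sub (by omega), Nat.cast_sub (by omega)]
        push_cast
        ring
  -- `R` is not assumed reflexive, since `JoinedIn S` is reflexive only on `S`; reflecting back and
  -- forth supplies this.
  have hR : Equivalence fun x y ↦ R (ρ x) (ρ y) :=
    ⟨fun x ↦ trans (hrefl x) (symm (hrefl x)), symm, trans⟩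
  have hhalf (k : ℕ) (hk : k < u + v) (z : ℤ) :
      R (ρ (k + 2 * (u + v) * z)) (ρ (k + 2 * (u + v) * z + 2 * u)) := by
    rw [hρ k (by omega)]
    by_cases hkv : k < 2 * v
    · rw [hρ' _ z (k + 2 * u) (by omega)]
      · exact hlow k hk hkv
      · push_cast
        ring
    · obtain ⟨m, rfl⟩ := Nat.exists_eq_add_of_le' (not_lt.1 hkv)
      rw [hρ' _ (z + 1) m (by omega)]
      · exact hhigh m hk
      · push_cast
        ring
  have htrans (x : ℤ) : R (ρ x) (ρ (x + 2 * u)) := by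
    obtain ⟨k, z, hk, rfl⟩ := hrep x
    by_cases hku : k < u + v
    · exact hhalf k hku z
    -- The map x ↦ -1 - x exchanges the two halves of the cycle. The chain is x ~ 2u - 1 - x ~ -1 -
    -- x ~ x + 2u, with the known half of the translation in the middle.
    · have h := hhalf (2 * (u + v) - 1 - k) (by omega) (-z - 1)
      have e : (((2 * (u + v) - 1 - k : ℕ) : ℤ) + 2 * (u + v) * (-z - 1)) =
          -1 - (k + 2 * (u + v) * z) := by
        rw [Nat.cast_sub (by omega), Nat.cast_sub (by omega)]
        push_cast
        ring
      rw [e] at h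
      have h1 := hrefl (-1 - (k + 2 * (u + v) * z))
      have h2 := hrefl (-1 - (k + 2 * (u + v) * z) + 2 * u)
      rw [show (2 * u - 1 - (-1 - (k + 2 * (u + v) * z)) : ℤ) = k + 2 * (u + v) * z + 2 * u by
        ring] at h1
      rw [show (2 * u - 1 - (-1 - (k + 2 * (u + v) * z) + 2 * u) : ℤ) = k + 2 * (u + v) * z by
        ring] at h2
      exact trans (symm h2) (trans (symm h) h1)
  have hcop : IsCoprime (u : ℤ) (u + v : ℤ) := by
    have := Nat.isCoprime_iff_coprime.2 huv
    simpa [add_comm] using this.add_mul_left_right 1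
  have hper (x : ℤ) : R (ρ x) (ρ (x + 2 * (u + v))) := by
    have : ρ (x + 2 * (u + v)) = ρ x := by
      obtain ⟨k, z, hk, rfl⟩ := hrep x
      rw [hρ k hk, hρ' _ (z + 1) k hk]
      ring
    rw [this]
    exact hR.refl x
  have := rel_of_translation_of_reflection hR hcop hper htrans hrefl k l
  rwa [hρ' k 0 k hk (by ring), hρ' l 0 l hl (by ring)] at this

end Cycle

end NormalSurfaces

/-! ### The chains of arcs for uF + vG -/

namespace NormalSurfaces

/-- The connections between the points of `uF + vG` on the ten edges of `triangulationB` that are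
made by some of the normal arcs suffice to connect all of them. -/
theorem rel_of_arcs {X : Type*} {R : X → X → Prop} {a : Fin 10 → ℕ → X} {u v : ℕ}
    (symm : ∀ {x y}, R x y → R y x) (trans : ∀ {x y z}, R x y → R y z → R x z)
    (huv : Nat.Coprime u v)
    (h01 : ∀ m < 2 * u + 2 * v, R (a 0 m) (a 1 m))
    (h02 : ∀ m < 2 * u + 2 * v, R (a 0 m) (a 2 m))
    (h04 : ∀ k l, k + l + 1 = 2 * u → R (a 0 k) (a 4 l))
    (h05 : ∀ m < 2 * v, R (a 0 (2 * u + m)) (a 5 m))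
    (h12 : ∀ m < 4 * u + 2 * v, R (a 1 m) (a 2 m))
    (h12' : ∀ k l, k + l + 1 = 4 * u + 2 * v → k < 3 * u + v → R (a 1 k) (a 2 l))
    (h13 : ∀ m < 2 * u + 2 * v, R (a 1 (2 * u + 2 * v + m)) (a 3 m))
    (h34 : ∀ m < 2 * u, R (a 3 m) (a 4 m))
    (h53 : ∀ k l, k + l + 1 = 2 * u + 2 * v → k < 2 * v → R (a 5 k) (a 3 l))
    (h73 : ∀ k l, k + l + 1 = 2 * u + 2 * v → R (a 7 k) (a 3 l))
    (h57 : ∀ k l, k + l + 1 = 2 * u + 4 * v → k < 2 * v → R (a 5 k) (a 7 l))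
    (h77 : ∀ k l, k + l + 1 = 2 * u + 4 * v → k < u + 3 * v → R (a 7 k) (a 7 l))
    (h27 : ∀ m < u + v, R (a 2 m) (a 7 m))
    (h67 : ∀ m < 2 * u + 2 * v, R (a 6 m) (a 7 m))
    (h28 : ∀ m < 3 * u + 2 * v, R (a 2 m) (a 8 m))
    (h68 : ∀ k l, k + l + 1 = 4 * u + 4 * v → k < 2 * u + 2 * v → R (a 6 k) (a 8 l))
    (h29 : ∀ k l, k + l + 1 = 2 * u + 2 * v → R (a 2 k) (a 9 l))
    (e : Fin 10) (m : ℕ)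
    (hm : m < u * (![2, 4, 4, 2, 2, 0, 2, 2, 4, 2] : Fin 10 → ℕ) e +
      v * (![2, 4, 2, 2, 0, 2, 2, 4, 4, 2] : Fin 10 → ℕ) e) : R (a 0 0) (a e m) := by
  -- Edge 3 repeats edge 0 with each of the blocks of lengths 2u and 2v reversed. The start of edge
  -- 7 is edge 3 reversed as a whole, so it shows the two blocks of edge 0 exchanged, each in its
  -- original order.
  have h3fst (k l : ℕ) (h : k + l + 1 = 2 * u) : R (a 3 k) (a 0 l) :=
    trans (h34 k (by omega)) (symm (h04 l k (by omega)))
  have h3snd (k l : ℕ) (h : k + l + 1 = 2 * v) : R (a 3 (2 * u + k)) (a 0 (2 * u + l)) :=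
    trans (symm (h53 l (2 * u + k) (by omega) (by omega))) (symm (h05 l (by omega)))
  have h7low (k : ℕ) (h : k < 2 * v) : R (a 7 k) (a 0 (2 * u + k)) :=
    trans (h73 k (2 * u + (2 * v - 1 - k)) (by omega)) (h3snd _ _ (by omega))
  have h7mid (k : ℕ) (h : k < 2 * u) : R (a 7 (2 * v + k)) (a 0 k) :=
    trans (h73 (2 * v + k) (2 * u - 1 - k) (by omega)) (h3fst _ _ (by omega))
  -- The reflection of all 2u + 4v points of edge 7 preserves the block 2v, ..., 2v + 2u - 1, a copy
  -- of the first block of edge 0.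
  have hfst_half (k l : ℕ) (h : k + l + 1 = 2 * u) (hk : k < u) : R (a 0 k) (a 0 l) :=
    trans (trans (symm (h7mid k (by omega))) (h77 (2 * v + k) (2 * v + l) (by omega) (by omega)))
      (h7mid l (by omega))
  have hfst (k l : ℕ) (h : k + l + 1 = 2 * u) : R (a 0 k) (a 0 l) := by
    by_cases hk : k < u
    · exact hfst_half k l h hk
    · exact symm (hfst_half l k (by omega) (by omega))
  -- The reversal of 4u + 2v points between edges 1 and 2 preserves the block 2u, ..., 2u + 2v - 1.
  have hsnd_half (k l : ℕ) (h : k + l + 1 = 2 * v) (hk : k < v) :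
      R (a 0 (2 * u + k)) (a 0 (2 * u + l)) :=
    trans (trans (h01 (2 * u + k) (by omega)) (h12' (2 * u + k) (2 * u + l) (by omega) (by omega)))
      (symm (h02 (2 * u + l) (by omega)))
  have hsnd (k l : ℕ) (h : k + l + 1 = 2 * v) : R (a 0 (2 * u + k)) (a 0 (2 * u + l)) := by
    by_cases hk : k < v
    · exact hsnd_half k l h hk
    · exact symm (hsnd_half l k (by omega) (by omega))
  -- Through edge 2, the first u + v points of edge 7 are also an unshifted copy of those of edge 0.
  -- Comparing this with the copy with exchanged blocks gives the cyclic shift.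
  have hlow (k : ℕ) (hk : k < u + v) (hkv : k < 2 * v) : R (a 0 k) (a 0 (k + 2 * u)) := by
    rw [add_comm k]
    exact trans (trans (h02 k (by omega)) (h27 k hk)) (h7low k hkv)
  have hhigh (k : ℕ) (hk : k + 2 * v < u + v) : R (a 0 (k + 2 * v)) (a 0 k) := by
    rw [add_comm k]
    exact trans (trans (h02 _ (by omega)) (h27 _ (by omega))) (h7mid k (by omega))
  have hpos : 0 < u + v := by
    rcases Nat.eq_zero_or_pos (u + v) with h | h
    · obtain ⟨rfl, rfl⟩ : u = 0 ∧ v = 0 := by omega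
      simp at huv
    · exact h
  have hR0 (m : ℕ) (hm : m < 2 * u + 2 * v) : R (a 0 0) (a 0 m) :=
    rel_of_reflections_of_translation (R := R) (a := a 0) (k := 0) (l := m) symm trans huv hfst hsnd
      hlow hhigh (by omega) (by omega)
  have hR3 (m : ℕ) (hm : m < 2 * u + 2 * v) : R (a 0 0) (a 3 m) := by
    by_cases h : m < 2 * u
    · exact trans (hR0 (2 * u - 1 - m) (by omega)) (symm (h3fst m _ (by omega)))
    · obtain ⟨k, rfl⟩ := Nat.exists_eq_add_of_le (not_lt.1 h)
      exact trans (hR0 (2 * u + (2 * v - 1 - k)) (by omega)) (symm (h3snd k _ (by omega)))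
  have hR1 (m : ℕ) (hm : m < 4 * u + 4 * v) : R (a 0 0) (a 1 m) := by
    by_cases h : m < 2 * u + 2 * v
    · exact trans (hR0 m h) (h01 m h)
    · obtain ⟨k, rfl⟩ := Nat.exists_eq_add_of_le (not_lt.1 h)
      exact trans (hR3 k (by omega)) (symm (h13 k (by omega)))
  have hR2 (m : ℕ) (hm : m < 4 * u + 2 * v) : R (a 0 0) (a 2 m) :=
    trans (hR1 m (by omega)) (h12 m hm)
  have hR5 (m : ℕ) (hm : m < 2 * v) : R (a 0 0) (a 5 m) :=
    trans (hR0 _ (by omega)) (h05 m hm)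
  have hR7 (m : ℕ) (hm : m < 2 * u + 4 * v) : R (a 0 0) (a 7 m) := by
    by_cases h : m < 2 * u + 2 * v
    · exact trans (hR3 (2 * u + 2 * v - 1 - m) (by omega)) (symm (h73 m _ (by omega)))
    · exact trans (hR5 (2 * u + 4 * v - 1 - m) (by omega)) (h57 _ m (by omega) (by omega))
  have hR6 (m : ℕ) (hm : m < 2 * u + 2 * v) : R (a 0 0) (a 6 m) :=
    trans (hR7 m (by omega)) (symm (h67 m hm))
  have hR8 (m : ℕ) (hm : m < 4 * u + 4 * v) : R (a 0 0) (a 8 m) := by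
    by_cases h : m < 2 * u + 2 * v
    · exact trans (hR2 m (by omega)) (h28 m (by omega))
    · exact trans (hR6 (4 * u + 4 * v - 1 - m) (by omega)) (h68 _ m (by omega) (by omega))
  fin_cases e <;> simp at hm
  · exact hR0 m (by omega)
  · exact hR1 m (by omega)
  · exact hR2 m (by omega)
  · exact hR3 m (by omega)
  · exact trans (hR0 (2 * u - 1 - m) (by omega)) (h04 _ m (by omega))
  · exact hR5 m (by omega)
  · exact hR6 m (by omega)
  · exact hR7 m (by omega)
  · exact hR8 m (by omega)
  · exact trans (hR2 (2 * u + 2 * v - 1 - m) (by omega)) (h29 _ m (by omega))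

/-! ### Edge classes of the triangulation -/

section Edges

variable {n : ℕ}

/-- The rotation around the edge `ij` of the tetrahedron `T` that crosses the face `f`; the other face
at this edge is `g`. -/
def FaceGluing.rotate (𝒯 : FaceGluing n) :
    Fin n × Fin 4 × Fin 4 × Fin 4 × Fin 4 → Fin n × Fin 4 × Fin 4 × Fin 4 × Fin 4
  | (T, i, j, f, g) =>
    (𝒯.tet T f, 𝒯.vert T f i, 𝒯.vert T f j, 𝒯.vert T f g, 𝒯.vert T f f)

/-- The edge of a state of the rotation. -/
def edgeOf : Fin n × Fin 4 × Fin 4 × Fin 4 × Fin 4 → Fin n × Fin 4 × Fin 4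
  | (T, i, j, _, _) => (T, i, j)

/-- The oriented edges `a` and `b` of tetrahedra are identified by a rotation with at most nine
steps. -/
def FaceGluing.SameEdge (𝒯 : FaceGluing n) (a b : Fin n × Fin 4 × Fin 4) : Prop :=
  ∃ f g, (a.2.1 ≠ f ∧ a.2.2 ≠ f ∧ a.2.1 ≠ g ∧ a.2.2 ≠ g) ∧ f ≠ g ∧ ∃ k : Fin 10,
    edgeOf (𝒯.rotate^[k] (a.1, a.2.1, a.2.2, f, g)) = b

instance (𝒯 : FaceGluing n) (a b : Fin n × Fin 4 × Fin 4) : Decidable (𝒯.SameEdge a b) := by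
  unfold FaceGluing.SameEdge
  infer_instance

variable {𝒯 : FaceGluing n} {c : NormalCoord n} {S : Set 𝒯.Space}

/-- Crossing a face preserves both the edge in the quotient and the end from which its points are
counted. -/
theorem edgeNth_iterate_rotate (S : Set 𝒯.Space) (m k : ℕ) (T : Fin n) {i j f g : Fin 4}
    (h : i ≠ f ∧ j ≠ f ∧ i ≠ g ∧ j ≠ g) {b : Fin n × Fin 4 × Fin 4}
    (hk : edgeOf (𝒯.rotate^[k] (T, i, j, f, g)) = b) :
    edgeNth S T i j m = edgeNth S b.1 b.2.1 b.2.2 m := by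
  induction k generalizing T i j f g with
  | zero =>
    subst hk
    rfl
  | succ k ih =>
    obtain ⟨hif, hjf, hig, hjg⟩ := h
    have inj := 𝒯.vert_injective T f
    rw [Function.iterate_succ_apply] at hk
    rw [← ih (𝒯.tet T f) ⟨inj.ne hig, inj.ne hjg, inj.ne hif, inj.ne hjf⟩ hk]
    exact (edgeNth_glue S T hif hjf m).symm

theorem FaceGluing.SameEdge.edgeNth_eq {a b : Fin n × Fin 4 × Fin 4} (h : 𝒯.SameEdge a b)
    (S : Set 𝒯.Space) (m : ℕ) :
    edgeNth S a.1 a.2.1 a.2.2 m = edgeNth S b.1 b.2.1 b.2.2 m := by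
  obtain ⟨f, g, hne, -, k, hk⟩ := h
  exact edgeNth_iterate_rotate S m k a.1 hne hk

theorem FaceGluing.Matching.weight_iterate_rotate (hc : 𝒯.Matching c) (k : ℕ) (T : Fin n)
    {i j f g : Fin 4} (hij : i ≠ j) (h : i ≠ f ∧ j ≠ f ∧ i ≠ g ∧ j ≠ g) {b : Fin n × Fin 4 × Fin 4}
    (hk : edgeOf (𝒯.rotate^[k] (T, i, j, f, g)) = b) :
    weight (c T) i j = weight (c b.1) b.2.1 b.2.2 := by
  induction k generalizing T i j f g with
  | zero =>
    subst hk
    rfl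
  | succ k ih =>
    obtain ⟨hif, hjf, hig, hjg⟩ := h
    have inj := 𝒯.vert_injective T f
    rw [Function.iterate_succ_apply] at hk
    rw [← ih (𝒯.tet T f) (inj.ne hij) ⟨inj.ne hig, inj.ne hjg, inj.ne hif, inj.ne hjf⟩ hk]
    exact hc.weight_eq hif hjf hij

theorem FaceGluing.SameEdge.weight_eq (hc : 𝒯.Matching c) {a b : Fin n × Fin 4 × Fin 4}
    (h : 𝒯.SameEdge a b) (ha : a.2.1 ≠ a.2.2) :
    weight (c a.1) a.2.1 a.2.2 = weight (c b.1) b.2.1 b.2.2 := by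
  obtain ⟨f, g, hne, -, k, hk⟩ := h
  exact hc.weight_iterate_rotate k a.1 ha hne hk

end Edges

section Sum

variable {n : ℕ}

theorem numArcs_smul_add_smul (c d : NormalCoord n) (u v : ℕ) (T : Fin n) (f i : Fin 4) :
    numArcs ((u • c + v • d) T) f i = u * numArcs (c T) f i + v * numArcs (d T) f i := by
  simp [numArcs, Finset.sum_add_distrib, Finset.mul_sum]

theorem weight_smul_add_smul (c d : NormalCoord n) (u v : ℕ) (T : Fin n) (i j : Fin 4) :
    weight ((u • c + v • d) T) i j = u * weight (c T) i j + v * weight (d T) i j := by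
  simp [weight, Finset.sum_add_distrib, Finset.mul_sum]

theorem FaceGluing.Matching.smul_add_smul {𝒯 : FaceGluing n} {c d : NormalCoord n}
    (hc : 𝒯.Matching c) (hd : 𝒯.Matching d) (u v : ℕ) : 𝒯.Matching (u • c + v • d) := by
  intro T f i hi
  rw [numArcs_smul_add_smul, numArcs_smul_add_smul, hc T f i hi, hd T f i hi]

end Sum

theorem matching_coordF : triangulationB.Matching coordF := by
  unfold FaceGluing.Matching
  decide

theorem matching_coordG : triangulationB.Matching coordG := by
  unfold FaceGluing.Matching
  decide

/-- Representatives of the ten edges of `triangulationB`. -/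
def edgeRep : Fin 10 → Fin 10 × Fin 4 × Fin 4 :=
  ![(0, 0, 1), (0, 0, 2), (0, 0, 3), (0, 1, 2), (0, 1, 3), (0, 2, 3), (1, 1, 2), (1, 1, 3),
    (3, 0, 2), (4, 1, 3)]

set_option maxRecDepth 10000 in
set_option maxHeartbeats 2000000 in
-- A finite check that the ten representatives cover all edges of all tetrahedra, up to orientation.
theorem exists_sameEdge_edgeRep_of_lt (T : Fin 10) (i j : Fin 4) (hij : i < j) :
    ∃ e, triangulationB.SameEdge (edgeRep e) (T, i, j) ∨
      triangulationB.SameEdge (edgeRep e) (T, j, i) := by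
  revert T i j
  decide

theorem exists_sameEdge_edgeRep (T : Fin 10) {i j : Fin 4} (hij : i ≠ j) :
    ∃ e, triangulationB.SameEdge (edgeRep e) (T, i, j) ∨
      triangulationB.SameEdge (edgeRep e) (T, j, i) := by
  rcases lt_or_gt_of_ne hij with h | h
  · exact exists_sameEdge_edgeRep_of_lt T i j h
  · exact (exists_sameEdge_edgeRep_of_lt T j i h).imp fun _ ↦ Or.symm

end NormalSurfaces

/-! ### Verification of the arcs, and conclusion -/

namespace NormalSurfaces

section Arcs

variable {u v : ℕ} {S : Set triangulationB.Space}

theorem joinedIn_edgeNth_of_sameEdge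
    (hS : IsNormalSurface triangulationB (u • coordF + v • coordG) S) (T : Fin 10)
    (f i j k : Fin 4) (a b : Fin 10 × Fin 4 × Fin 4) {r s : ℕ}
    (h : (j ≠ i ∧ j ≠ f ∧ k ≠ i ∧ k ≠ f ∧ i ≠ f) ∧
      (triangulationB.SameEdge (T, i, j) a ∧ triangulationB.SameEdge (T, i, k) b) ∧
      numArcs (coordF T) f i = r ∧ numArcs (coordG T) f i = s) {m : ℕ} (hm : m < u * r + v * s) :
    JoinedIn S (edgeNth S a.1 a.2.1 a.2.2 m) (edgeNth S b.1 b.2.1 b.2.2 m) := by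
  obtain ⟨⟨hji, hjf, hki, hkf, hif⟩, ⟨ha, hb⟩, rfl, rfl⟩ := h
  rw [← numArcs_smul_add_smul] at hm
  rw [← ha.edgeNth_eq S m, ← hb.edgeNth_eq S m]
  exact hS.joinedIn_edgeNth T hji hjf hki hkf hif hm

theorem edgeNth_rev_of_weight
    (hS : IsNormalSurface triangulationB (u • coordF + v • coordG) S) (a : Fin 10 × Fin 4 × Fin 4)
    {r s : ℕ} (h : a.2.1 ≠ a.2.2 ∧ weight (coordF a.1) a.2.1 a.2.2 = r ∧
      weight (coordG a.1) a.2.1 a.2.2 = s) {m m' : ℕ} (hm : m + m' + 1 = u * r + v * s) :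
    edgeNth S a.1 a.2.2 a.2.1 m' = edgeNth S a.1 a.2.1 a.2.2 m := by
  obtain ⟨hne, rfl, rfl⟩ := h
  rw [← weight_smul_add_smul] at hm
  exact (hS.edgeNth_rev a.1 hne hm).symm

end Arcs

theorem weight_edgeRep (e : Fin 10) :
    weight (coordF (edgeRep e).1) (edgeRep e).2.1 (edgeRep e).2.2 =
        (![2, 4, 4, 2, 2, 0, 2, 2, 4, 2] : Fin 10 → ℕ) e ∧
      weight (coordG (edgeRep e).1) (edgeRep e).2.1 (edgeRep e).2.2 =
        (![2, 4, 2, 2, 0, 2, 2, 4, 4, 2] : Fin 10 → ℕ) e ∧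
      (edgeRep e).2.1 ≠ (edgeRep e).2.2 := by
  revert e
  decide

set_option maxRecDepth 2000 in
/-- All points of a normal surface `uF + vG` on the edges of `triangulationB` are connected in the
surface if `u` and `v` are coprime. -/
theorem joinedIn_edgeNth_edgeRep {u v : ℕ} (huv : Nat.Coprime u v)
    {S : Set triangulationB.Space}
    (hS : IsNormalSurface triangulationB (u • coordF + v • coordG) S) (e : Fin 10) (m : ℕ)
    (hm : m < u * (![2, 4, 4, 2, 2, 0, 2, 2, 4, 2] : Fin 10 → ℕ) e +
      v * (![2, 4, 2, 2, 0, 2, 2, 4, 4, 2] : Fin 10 → ℕ) e) :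
    JoinedIn S (edgeNth S 0 0 1 0)
      (edgeNth S (edgeRep e).1 (edgeRep e).2.1 (edgeRep e).2.2 m) := by
  have arc := fun T f i j k a b r s h m ↦
    joinedIn_edgeNth_of_sameEdge hS T f i j k a b (r := r) (s := s) h (m := m)
  -- Some arcs are counted from the end opposite to the orientation of the representative. This
  -- turns the index k into l with k + l + 1 the weight of the edge, the form of several hypotheses
  -- of `rel_of_arcs`.
  have rev := fun a r s h m m' ↦ edgeNth_rev_of_weight hS a (r := r) (s := s) h (m := m) (m' := m')
  have rev0 := rev (0, 0, 1) 2 2 (by decide)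
  have rev1 := rev (0, 0, 2) 4 4 (by decide)
  have rev2 := rev (0, 0, 3) 4 2 (by decide)
  have rev3 := rev (0, 1, 2) 2 2 (by decide)
  have rev4 := rev (0, 1, 3) 2 0 (by decide)
  have rev5 := rev (0, 2, 3) 0 2 (by decide)
  have rev7 := rev (1, 1, 3) 2 4 (by decide)
  have rev8 := rev (3, 0, 2) 4 4 (by decide)
  have rev9 := rev (4, 1, 3) 2 2 (by decide)
  refine rel_of_arcs (R := JoinedIn S)
    (a := fun e ↦ edgeNth S (edgeRep e).1 (edgeRep e).2.1 (edgeRep e).2.2) JoinedIn.symm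
    JoinedIn.trans huv ?_ ?_ ?_ ?_ ?_ ?_ ?_ ?_ ?_ ?_ ?_ ?_ ?_ ?_ ?_ ?_ ?_ e m hm
  · intro m hm
    exact arc 0 3 0 1 2 (0, 0, 1) (0, 0, 2) 2 2 (by decide) m (by omega)
  · intro m hm
    exact arc 0 2 0 1 3 (0, 0, 1) (0, 0, 3) 2 2 (by decide) m (by omega)
  · intro k l h
    exact rev4 l k (by omega) ▸ arc 5 0 2 1 3 (0, 0, 1) (0, 3, 1) 2 0 (by decide) k (by omega)
  · intro m hm
    exact rev0 (2 * u + m) (2 * v - 1 - m) (by omega) ▸ rev5 m (2 * v - 1 - m) (by omega) ▸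
      arc 5 0 1 2 3 (0, 1, 0) (0, 3, 2) 0 2 (by decide) (2 * v - 1 - m) (by omega)
  · intro m hm
    exact arc 0 1 0 2 3 (0, 0, 2) (0, 0, 3) 4 2 (by decide) m (by omega)
  · intro k l h hk
    exact rev2 l k (by omega) ▸ arc 1 2 0 3 1 (0, 0, 2) (0, 3, 0) 3 1 (by decide) k (by omega)
  · intro m hm
    exact rev1 (2 * u + 2 * v + m) (2 * u + 2 * v - 1 - m) (by omega) ▸
      rev3 m (2 * u + 2 * v - 1 - m) (by omega) ▸
      arc 0 3 2 0 1 (0, 2, 0) (0, 2, 1) 2 2 (by decide) (2 * u + 2 * v - 1 - m) (by omega)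
  · intro m hm
    exact arc 0 0 1 2 3 (0, 1, 2) (0, 1, 3) 2 0 (by decide) m (by omega)
  · intro k l h hk
    exact rev3 l k (by omega) ▸ arc 0 0 2 3 1 (0, 2, 3) (0, 2, 1) 0 2 (by decide) k (by omega)
  · intro k l h
    exact rev3 l k (by omega) ▸ arc 2 1 0 3 2 (1, 1, 3) (0, 2, 1) 2 2 (by decide) k (by omega)
  · intro k l h hk
    exact rev7 l k (by omega) ▸ arc 1 0 3 2 1 (0, 2, 3) (1, 3, 1) 0 2 (by decide) k (by omega)
  · intro k l h hk
    exact rev7 l k (by omega) ▸ arc 6 3 0 2 1 (1, 1, 3) (1, 3, 1) 1 3 (by decide) k (by omega)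
  · intro m hm
    exact arc 1 2 1 0 3 (0, 0, 3) (1, 1, 3) 1 1 (by decide) m (by omega)
  · intro m hm
    exact arc 1 0 1 2 3 (1, 1, 2) (1, 1, 3) 2 2 (by decide) m (by omega)
  · intro m hm
    exact arc 3 1 0 3 2 (0, 0, 3) (3, 0, 2) 3 2 (by decide) m (by omega)
  · intro k l h hk
    exact rev8 l k (by omega) ▸ arc 4 2 0 1 3 (1, 1, 2) (3, 2, 0) 2 2 (by decide) k (by omega)
  · intro k l h
    exact rev9 l k (by omega) ▸ arc 6 0 1 3 2 (0, 0, 3) (4, 3, 1) 2 2 (by decide) k (by omega)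

theorem isPathConnected_of_coprime {u v : ℕ} (huv : Nat.Coprime u v)
    {S : Set triangulationB.Space}
    (hS : IsNormalSurface triangulationB (u • coordF + v • coordG) S) : IsPathConnected S := by
  -- Coprimality excludes u = v = 0, so edge 0 carries a base point.
  have hpos : 0 < u * 2 + v * 2 := by
    by_contra h
    obtain ⟨rfl, rfl⟩ : u = 0 ∧ v = 0 := by omega
    simp at huv
  refine ⟨edgeNth S 0 0 1 0, (joinedIn_edgeNth_edgeRep huv hS 0 0 hpos).mem.1, fun {q} hq ↦ ?_⟩
  obtain ⟨T, i, j, m, hij, hm, hjoin⟩ := hS.exists_joinedIn_edgeNth hq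
  refine JoinedIn.trans ?_ hjoin.symm
  have hc := matching_coordF.smul_add_smul matching_coordG u v
  obtain ⟨e, he⟩ := exists_sameEdge_edgeRep T hij
  obtain ⟨hF, hG, hne⟩ := weight_edgeRep e
  have key (m : ℕ) (T' : Fin 10) (i' j' : Fin 4)
      (h : triangulationB.SameEdge (edgeRep e) (T', i', j'))
      (hm : m < weight ((u • coordF + v • coordG) T') i' j') :
      JoinedIn S (edgeNth S 0 0 1 0) (edgeNth S T' i' j' m) := by
    have hw := h.weight_eq hc hne
    rw [weight_smul_add_smul, hF, hG] at hw
    rw [← h.edgeNth_eq S m]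
    exact joinedIn_edgeNth_edgeRep huv hS e m (hw ▸ hm)
  rcases he with he | he
  · exact key m T i j he hm
  -- The representative has the opposite orientation, so the point is counted from the other end.
  · rw [hS.edgeNth_rev T hij (m := m) (m' := weight ((u • coordF + v • coordG) T) i j - 1 - m)
      (by omega)]
    refine key _ T j i he ?_
    rw [weight_comm _ j i]
    omega

end NormalSurfaces

theorem lemma2 (u v : ℕ) (huv : Nat.gcd u v = 1) :
    (∃ S : Set NormalSurfaces.triangulationB.Space,
      NormalSurfaces.IsNormalSurface NormalSurfaces.triangulationB
        (u • NormalSurfaces.coordF + v • NormalSurfaces.coordG) S) ∧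
    ∀ S : Set NormalSurfaces.triangulationB.Space,
      NormalSurfaces.IsNormalSurface NormalSurfaces.triangulationB
        (u • NormalSurfaces.coordF + v • NormalSurfaces.coordG) S →
      IsConnected S :=
  ⟨(NormalSurfaces.matching_coordF.smul_add_smul NormalSurfaces.matching_coordG u
    v).exists_isNormalSurface,
    fun _ hS ↦ (NormalSurfaces.isPathConnected_of_coprime huv hS).isConnected⟩
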